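/- **Setting.** A two-player zero-sum episodic Markov game has $H$ steps, a measurable state space $\mathcal S$, finite nonempty action sets $\mathcal A$ (max-player) and $\mathcal B$ (min-player), a fixed initial state $s_1$, transition kernels $\mathbb P_h(\cdot\mid s,a,b)$, and deterministic nonnegative measurable rewards $r_h(s,a,b)$ with $\sum_{h=1}^H r_h(s_h,a_h,b_h)\le 1$ along every possible trajectory (almost surely, under every pair of policies). A Markov policy $\mu$ of the max-player (resp. $\nu$ of the min-player) assigns measurably to each step $h$ and state $s$ a distribution $\mu_h(s)\in\Delta_{\mathcal A}$ (resp. $\nu_h(s)\in\Delta_{\mathcal B}$). $V_h^{\mu,\nu}(s)$ and $Q_h^{\mu,\nu}(s,a,b)$ denote the expected cumulative reward from step $h$ to the end, given $s_h=s$, resp. $(s_h,a_h,b_h)=(s,a,b)$, and $V^\star_h=\sup_\mu\inf_\nu V^{\mu,\nu}_h$, $Q^\star_h=\sup_\mu\inf_\nu Q^{\mu,\nu}_h$ are the Nash value functions. Let $\mathcal F=\mathcal F_1\times\dots\times\mathcal F_H$ and $\mathcal G=\mathcal G_1\times\dots\times\mathcal G_H$ be finite classes of measurable functions, $\mathcal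 F_h,\mathcal G_h\subseteq(\mathcal S\times\mathcal A\times\mathcal B\to[0,1])$, and put $f_{H+1}=0$. For $f\in\mathcal F$ let $V_{f,h}(s)=\max_{x\in\Delta_{\mathcal A}}\min_{y\in\Delta_{\mathcal B}}x^\top f_h(s,\cdot,\cdot)y$ (so $V_{f,H+1}=0$), let $\mu_f$ be a policy for which $\mu_{f,h}(s)$ attains this maximum for all $(s,h)$, and let $(\mathcal T_hf_{h+1})(s,a,b)=r_h(s,a,b)+\mathbb E_{s'\sim\mathbb P_h(\cdot\mid s,a,b)}V_{f,h+1}(s')$. *Dimension.* A probability measure $\rho$ is $\epsilon$-independent of $\rho_1,\dots,\rho_n$ with respect to a function class $\mathcal H$ if some $g\in\mathcal H$ satisfies $\sqrt{\sum_{i\le n}(\mathbb E_{\rho_i}g)^2}\le\epsilon$ and $|\mathbb E_\rho g|>\epsilon$. $\dim_{\rm DE}(\mathcal H,\Pi,\epsilon)$ is the length of the longest sequence in $\Pi$ such that, for some $\epsilon'\ge\epsilon$, each element is $\epsilon'$-independent of its predecessors. The online Bellman–Eluder dimension is $\dim_{\rm OBE}(\mathcal F,\epsilon)=\max_{h}\dim_{\rm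 DE}(\{f_h-\mathcal T_hf_{h+1}: f\in\mathcal F\},\Pi_\Delta,\epsilon)$, where $\Pi_\Delta$ is the set of all point masses on $\mathcal S\times\mathcal A\times\mathcal B$. *Algorithm, played by the max-player for $K$ episodes with parameter $\beta$.* In episode $k=1,\dots,K$ let $\mathcal C^k$ be the set of all $f\in\mathcal F$ such that for every $h$ $$L^k_h(f_h,f_{h+1})\le\inf_{g\in\mathcal G_h}L^k_h(g,f_{h+1})+\beta,\qquad L^k_h(\xi,f_{h+1})=\sum_{t<k}\bigl[\xi(s^t_h,a^t_h,b^t_h)-r_h(s_h^t,a_h^t,b_h^t)-V_{f,h+1}(s^t_{h+1})\bigr]^2$$ (with $\mathcal C^1=\mathcal F$). The max-player chooses $f^k\in\arg\max_{f\in\mathcal C^k}V_{f,1}(s_1)$ (an arbitrary $f^k\in\mathcal F$ if $\mathcal C^k=\emptyset$) and sets $\mu^k=\mu_{f^k}$, ties being broken arbitrarily. An adversary chooses an arbitrary Markov policy $\nu^k$ of the min-player, which may depend on everything that has happened so far, on $\mu^k$, and on additional randomness. Then one trajectory $(s^k_h,a^k_h,b^k_h)_{h\le H}$ is sampled from the game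 under $(\mu^k,\nu^k)$. **Theorem.** There are absolute constants $c,C>0$ such that the following holds. Suppose that for all $h\in[H]$ and $f\in\mathcal F$ one has $\min_{q\in\mathcal F_h}\|Q^\star_h-q\|_\infty\le\varepsilon_{\rm real}$ and $\min_{g\in\mathcal G_h}\|\mathcal T_hf_{h+1}-g\|_\infty\le\varepsilon_{\rm comp}$. Let $\delta\in(0,1]$, $K\in\mathbb N$, and run the algorithm with $$\beta=c\Bigl(\log\frac{KH|\mathcal F||\mathcal G|}{\delta}+K\varepsilon_{\rm comp}^2+K\varepsilon_{\rm real}^2\Bigr).$$ Then, against every adversary, with probability at least $1-\delta$, for all $k\le K$ simultaneously, $$\sum_{t=1}^k\bigl[V^\star_1(s_1)-V_1^{\mu^t,\nu^t}(s_1)\bigr]\le C\,H\sqrt{\max\{d,1\}\,k\,\beta},\qquad d=\dim_{\rm OBE}(\mathcal F,1/K).$$ -/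

import Mathlib

open MeasureTheory ProbabilityTheory
open scoped ENNReal

noncomputable section

namespace MarkovGames

/-! ### Matrix games -/

section MatrixGame

variable {A B : Type*} [Fintype A] [Fintype B]

/-- The bilinear payoff `xᵀ M y`. -/
def payoff (M : A → B → ℝ) (x : A → ℝ) (y : B → ℝ) : ℝ :=
  ∑ a, ∑ b, x a * M a b * y b

/-- `min_{y ∈ Δ_B} xᵀ M y`. -/
def guaranteed (M : A → B → ℝ) (x : A → ℝ) : ℝ :=
  ⨅ y : stdSimplex ℝ B, payoff M x (y : B → ℝ)

/-- `max_{x ∈ Δ_A} min_{y ∈ Δ_B} xᵀ M y`. -/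
def matrixValue (M : A → B → ℝ) : ℝ :=
  ⨆ x : stdSimplex ℝ A, guaranteed M (x : A → ℝ)

end MatrixGame

/-! ### Policies and trajectories -/

/-- A Markov policy: at each of the `H` steps, a measurable map from states to distributions over
the action set `A`. -/
structure Policy (H : ℕ) (S A : Type*) [MeasurableSpace S] [MeasurableSpace A] where
  ker : Fin H → Kernel S A
  markov : ∀ h, IsMarkovKernel (ker h)

/-- The vector in the probability simplex over `A` that the policy plays at step `h`, state `s`. -/
def Policy.probs {H : ℕ} {S A : Type*} [MeasurableSpace S] [MeasurableSpace A]
    (μ : Policy H S A) (h : Fin H) (s : S) (a : A) : ℝ :=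
  (μ.ker h s).real {a}

/-- At step `h` in state `s`: the law of `(s, a, b)` where `a ∼ μ_h(s)` and `b ∼ ν_h(s)` are drawn
independently. -/
def stepKer {H : ℕ} {S A B : Type*} [MeasurableSpace S] [MeasurableSpace A] [MeasurableSpace B]
    (μ : Policy H S A) (ν : Policy H S B) (h : Fin H) : Kernel S (S × A × B) :=
  Kernel.id ×ₖ (μ.ker h ×ₖ ν.ker h)

/-- The law of an `n`-step trajectory started from a given state: draw `z_0` by `step 0`, move to
the next state by `trans 0`, and go on with the remaining `n - 1` steps. -/
def rollout {S Z : Type*} [MeasurableSpace S] [MeasurableSpace Z] :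
    {n : ℕ} → (step : Fin n → Kernel S Z) → (trans : Fin n → Kernel Z S) → Kernel S (Fin n → Z)
  | 0, _, _ => Kernel.const S (Measure.dirac Fin.elim0)
  | n + 1, κ, p =>
    (κ 0 ⊗ₖ
      Kernel.prodMkLeft S (rollout (fun i : Fin n => κ i.succ) (fun i => p i.succ)
        ∘ₖ p 0)).map
      (fun w => (Fin.cons w.1 w.2 : Fin (n + 1) → Z))

/-! ### Two-player zero-sum episodic Markov games -/

/-- A two-player zero-sum Markov game with `H` steps per episode, fixed initial state and
deterministic nonnegative rewards whose sum over an episode is at most `1` along every possible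
trajectory, that is, almost surely whatever policies the two players use.
Steps are numbered from `0`: in the indexing `1, …, H`, step `h` is the element `h - 1` of `Fin H`. After the
last step the episode ends. -/
structure Game (H : ℕ) (S A B : Type*)
    [MeasurableSpace S] [MeasurableSpace A] [MeasurableSpace B] where
  init : S
  trans : Fin H → Kernel (S × A × B) S
  trans_markov : ∀ h, IsMarkovKernel (trans h)
  reward : Fin H → S × A × B → ℝ
  reward_measurable : ∀ h, Measurable (reward h)
  reward_nonneg : ∀ h z, 0 ≤ reward h z
  reward_sum_le : ∀ (μ : Policy H S A) (ν : Policy H S B),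
    ∀ᵐ τ ∂(rollout (stepKer μ ν) trans init), ∑ h, reward h (τ h) ≤ 1

namespace Game

variable {H : ℕ} {S A B : Type*} [MeasurableSpace S] [MeasurableSpace A] [MeasurableSpace B]
variable (M : Game H S A B)

/-- The law of one whole episode `(s_h, a_h, b_h)_h` played with `(μ, ν)`. -/
def episodeLaw (μ : Policy H S A) (ν : Policy H S B) : Measure (Fin H → S × A × B) :=
  rollout (stepKer μ ν) M.trans M.init

/-- The law of the part of the trajectory from step `h` to the end, given the state at step `h`. -/
def rolloutFrom (μ : Policy H S A) (ν : Policy H S B) (h : ℕ) :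
    Kernel S (Fin (H - h) → S × A × B) :=
  rollout (fun i => stepKer μ ν ⟨h + i, by omega⟩) (fun i => M.trans ⟨h + i, by omega⟩)

/-- Cumulative reward of a partial trajectory that starts at step `h`. -/
def rewardFrom (h : ℕ) (τ : Fin (H - h) → S × A × B) : ℝ :=
  ∑ i : Fin (H - h), M.reward ⟨h + i, by omega⟩ (τ i)

/-- `V_h^{μ,ν}(s)`: expected cumulative reward from step `h` on, given the state at step `h`. -/
def V (μ : Policy H S A) (ν : Policy H S B) (h : ℕ) (s : S) : ℝ :=
  ∫ τ, M.rewardFrom h τ ∂(M.rolloutFrom μ ν h s)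

/-- `Q_h^{μ,ν}(s,a,b)`: expected cumulative reward from step `h` on, given the state and the two
actions at step `h`. -/
def Q (μ : Policy H S A) (ν : Policy H S B) (h : Fin H) (z : S × A × B) : ℝ :=
  M.reward h z +
    ∫ τ, M.rewardFrom (h + 1) τ ∂((M.rolloutFrom μ ν (h + 1) ∘ₖ M.trans h) z)

/-- Nash value function `V_h^⋆(s) = sup_μ inf_ν V_h^{μ,ν}(s)`. -/
def Vstar (h : ℕ) (s : S) : ℝ :=
  ⨆ μ : Policy H S A, ⨅ ν : Policy H S B, M.V μ ν h s

/-- Nash action-value function `Q_h^⋆(s,a,b) = sup_μ inf_ν Q_h^{μ,ν}(s,a,b)`. -/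
def Qstar (h : Fin H) (z : S × A × B) : ℝ :=
  ⨆ μ : Policy H S A, ⨅ ν : Policy H S B, M.Q μ ν h z

end Game

/-! ### Function approximation -/

section FunctionApproximation

variable {H : ℕ} {S A B : Type*} [Fintype A] [Fintype B]

/-- The Nash value function `V_{f,h}` induced by `f`, with `f_{H+1} = 0`. -/
def inducedV (f : Fin H → S × A × B → ℝ) (h : ℕ) (s : S) : ℝ :=
  if hh : h < H then matrixValue (fun a b => f ⟨h, hh⟩ (s, a, b)) else 0

variable [MeasurableSpace S] [MeasurableSpace A] [MeasurableSpace B]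

/-- `μ` is a Nash policy of the max-player induced by `f`: at every step and state it attains
`max_{x ∈ Δ_A} min_{y ∈ Δ_B} xᵀ f_h(s,·,·) y`. Ties are broken arbitrarily. -/
def IsInducedPolicy (f : Fin H → S × A × B → ℝ) (μ : Policy H S A) : Prop :=
  ∀ h s, ∀ x ∈ stdSimplex ℝ A,
    guaranteed (fun a b => f h (s, a, b)) x ≤ guaranteed (fun a b => f h (s, a, b)) (μ.probs h s)

/-- The Nash Bellman operator `(T_h f)(s,a,b) = r_h(s,a,b) + E_{s' ∼ P_h(·|s,a,b)} V_{f,h+1}(s')`. -/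
def Game.bellman (M : Game H S A B) (f : Fin H → S × A × B → ℝ) (h : Fin H) (z : S × A × B) : ℝ :=
  M.reward h z + ∫ s', inducedV f (h + 1) s' ∂(M.trans h z)

/-- Membership in the product class `F = F_1 × ⋯ × F_H`. -/
def InClass (F : Fin H → Finset (S × A × B → ℝ)) (f : Fin H → S × A × B → ℝ) : Prop :=
  ∀ h, f h ∈ F h

/-- Cardinality of the product class. -/
def classCard (F : Fin H → Finset (S × A × B → ℝ)) : ℕ := ∏ h, (F h).card

/-- The class consists of measurable functions with values in `[0,1]`. -/
def IsValueClass (F : Fin H → Finset (S × A × B → ℝ)) : Prop :=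
  ∀ h, ∀ q ∈ F h, Measurable q ∧ ∀ z, 0 ≤ q z ∧ q z ≤ 1

/-- Every `Q_h^⋆` lies within sup-distance `ε` of its `L^∞` projection onto `F_h`. -/
def Game.Realizable (M : Game H S A B) (F : Fin H → Finset (S × A × B → ℝ)) (ε : ℝ) : Prop :=
  ∀ h, ∃ q ∈ F h, ∀ z, |M.Qstar h z - q z| ≤ ε

/-- Every `T_h f`, `f ∈ F`, lies within sup-distance `ε` of its `L^∞` projection onto `G_h`. -/
def Game.Complete (M : Game H S A B) (F G : Fin H → Finset (S × A × B → ℝ)) (ε : ℝ) : Prop :=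
  ∀ f, InClass F f → ∀ h, ∃ g ∈ G h, ∀ z, |M.bellman f h z - g z| ≤ ε

end FunctionApproximation

/-! ### Eluder dimensions -/

section Eluder

variable {X : Type*} [MeasurableSpace X]

/-- `ν` is `ε`-independent of the measures `μ i`, `i ∈ I`, with respect to the class `𝒢`. -/
def EpsIndependent {ι : Type*} (𝒢 : Set (X → ℝ)) (ε : ℝ) (I : Finset ι) (μ : ι → Measure X)
    (ν : Measure X) : Prop :=
  ∃ g ∈ 𝒢, √(∑ i ∈ I, (∫ x, g x ∂(μ i)) ^ 2) ≤ ε ∧ ε < |∫ x, g x ∂ν|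

/-- Distributional Eluder dimension: the largest length (possibly `⊤`) of a sequence in `𝒟` for
which some `ε' ≥ ε` makes every element `ε'`-independent of its predecessors. -/
def dimDE (𝒢 : Set (X → ℝ)) (𝒟 : Set (Measure X)) (ε : ℝ) : ℕ∞ :=
  sSup {N : ℕ∞ | ∃ n : ℕ, N = n ∧ ∃ ρ : Fin n → Measure X, (∀ i, ρ i ∈ 𝒟) ∧
    ∃ ε', ε ≤ ε' ∧ ∀ i, EpsIndependent 𝒢 ε' (Finset.Iio i) ρ (ρ i)}

variable {H : ℕ} {S A B : Type*} [Fintype A] [Fintype B]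
  [MeasurableSpace S] [MeasurableSpace A] [MeasurableSpace B]

/-- Residuals `f_h - T_h f_{h+1}`, `f ∈ F`, of the Nash Bellman operator at step `h`. -/
def Game.residuals (M : Game H S A B) (F : Fin H → Finset (S × A × B → ℝ)) (h : Fin H) :
    Set (S × A × B → ℝ) :=
  {g | ∃ f, InClass F f ∧ g = fun z => f h z - M.bellman f h z}

/-- Online Bellman-Eluder dimension, over the family of point masses. -/
def Game.dimOBE (M : Game H S A B) (F : Fin H → Finset (S × A × B → ℝ)) (ε : ℝ) : ℕ∞ :=
  ⨆ h : Fin H, dimDE (M.residuals F h)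
    (Set.range (Measure.dirac : S × A × B → Measure (S × A × B))) ε

end Eluder

/-! ### The algorithm against an adversary -/

section Algorithm

variable {H : ℕ} {S A B : Type*} [Fintype A] [Fintype B]
  [MeasurableSpace S] [MeasurableSpace A] [MeasurableSpace B]
variable (M : Game H S A B)

/-- Squared loss at step `h` on the data of the episodes `0, …, k - 1` with trajectories `τ`:
`∑ [ξ(s_h,a_h,b_h) - r_h - V_{ζ,h+1}(s_{h+1})]²`. After the last step `V_{ζ,H+1} = 0`. -/
def Game.loss (τ : ℕ → Fin H → S × A × B) (k : ℕ) (h : Fin H)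
    (ξ : S × A × B → ℝ) (ζ : Fin H → S × A × B → ℝ) : ℝ :=
  ∑ t ∈ Finset.range k,
    (ξ (τ t h) - M.reward h (τ t h)
      - (if hh : (h : ℕ) + 1 < H then inducedV ζ (h + 1) (τ t ⟨h + 1, hh⟩).1 else 0)) ^ 2

/-- The confidence set after `k` episodes: those `f ∈ F` with
`L_{D_h}(f_h, f_{h+1}) ≤ inf_{g ∈ G_h} L_{D_h}(g, f_{h+1}) + β` for all `h`;
before the first episode it is `F`. -/
def Game.confSet (F G : Fin H → Finset (S × A × B → ℝ)) (β : ℝ)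
    (τ : ℕ → Fin H → S × A × B) (k : ℕ) : Set (Fin H → S × A × B → ℝ) :=
  {f | InClass F f ∧ (0 < k → ∀ h,
    M.loss τ k h (f h) f ≤ (⨅ g : {g // g ∈ G h}, M.loss τ k h g.1 f) + β)}

/-- `K` episodes (numbered `0, …, K - 1`) of the optimistic algorithm of the max-player against an
adversary, on a probability space `(Ω, P)`. Here `𝓖 k` is the information available at the moment
when episode `k` is about to be played: it contains all earlier trajectories, the choices of both
players for episode `k`, and possibly any further randomness of theirs. -/
structure IsOnlineRun {Ω : Type*} [mΩ : MeasurableSpace Ω] (P : Measure Ω)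
    (F G : Fin H → Finset (S × A × B → ℝ)) (β : ℝ) (K : ℕ) (𝓖 : Filtration ℕ mΩ)
    (f : ℕ → Ω → Fin H → S × A × B → ℝ)
    (μ : ℕ → Ω → Policy H S A) (ν : ℕ → Ω → Policy H S B)
    (τ : ℕ → Ω → Fin H → S × A × B) : Prop where
  /-- The learner's `f^k` is a function in `F`, chosen from the information at hand. -/
  f_mem : ∀ k < K, ∀ ω, InClass F (f k ω)
  f_measurable : ∀ k < K, ∀ q, MeasurableSet[𝓖 k] {ω | f k ω = q}
  /-- Optimistic planning: `f^k` maximizes `V_{f,1}(s_1)` over the confidence set (in the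
  exceptional event that this set is empty, `f^k` is an arbitrary element of `F`). -/
  optimistic : ∀ k < K, ∀ ω, (M.confSet F G β (fun t => τ t ω) k).Nonempty →
    f k ω ∈ M.confSet F G β (fun t => τ t ω) k ∧
    ∀ g ∈ M.confSet F G β (fun t => τ t ω) k,
      inducedV g 0 M.init ≤ inducedV (f k ω) 0 M.init
  /-- The max-player plays a Nash policy induced by `f^k`. -/
  greedy : ∀ k < K, ∀ ω, IsInducedPolicy (f k ω) (μ k ω)
  μ_measurable : ∀ k < K, ∀ h a,
    Measurable[(𝓖 k).prod inferInstance] (fun p : Ω × S => (μ k p.1).ker h p.2 {a})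
  /-- The adversary's policy may depend in any (measurable) way on the information at hand. -/
  ν_measurable : ∀ k < K, ∀ h b,
    Measurable[(𝓖 k).prod inferInstance] (fun p : Ω × S => (ν k p.1).ker h p.2 {b})
  /-- Episode `k` is known after it was played. -/
  τ_measurable : ∀ k < K, Measurable[𝓖 (k + 1)] (τ k)
  /-- Given the information at hand, episode `k` is a trajectory of the game under
  `(μ^k, ν^k)`. -/
  τ_law : ∀ k < K, ∀ E, MeasurableSet E →
    P⟦τ k ⁻¹' E | 𝓖 k⟧ =ᵐ[P] fun ω => (M.episodeLaw (μ k ω) (ν k ω)).real E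

end Algorithm

end MarkovGames

end

open MeasureTheory ProbabilityTheory
open scoped ENNReal

noncomputable section

namespace MarkovGames

/-! ### Matrix games: continuity, monotonicity and measurability of the max-min value. -/

section MatrixGame

variable {A B : Type*} [Fintype A] [Fintype B]

/-! Optimism turns regret into Bellman residuals. Let `fstar` in F approximate Q⋆ within ε_real.
While `fstar` lies in every confidence set, V⋆_1 ≤ V_{f^t,1} + ε_real at the initial state. The
greedy policy secures V_{f^t,h} at each step against whatever the opponent plays, so V_{f^t,1} -
V_1^{μ^t,ν^t} is at most the expected sum of the residuals f_h - T_h f along an episode played with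
(μ^t, ν^t) (`inducedV_sub_V_le`). Nothing about the opponent enters, hence the arbitrary adversary.

Three estimates then suffice; Λ denotes the logarithm in β.

Regression. With w = ξ - T_h f, the loss of ξ is Σ w² - 2 Σ w · noise + Σ noise², and the last sum
does not depend on ξ. Given the past, the noise is centred in an interval of length one, so
Hoeffding's lemma bounds the mean of exp(2 w · noise - w²/2) by 1. Chernoff and a union bound over
functions, steps and episodes give |2 Σ w · noise| ≤ Σ w²/2 + L, which is `NoiseControlled`. On this
event `fstar` is in all confidence sets (`mem_confSet`), and members of a confidence set have
squared residuals on the past data summing to O(β) (`sum_residual_sq_le`).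

Deviation. The same exponential method replaces expected residual sums by observed ones at cost O(H
√(kΛ)) (`sum_integral_residualSum_le`).

Eluder dimension. Residuals that are square-small on the past satisfy Σ |residual| = O(√(dkβ)) at
the points actually visited (`sum_abs_le_of_dimDE`); summing over the steps gives the factor H.

That `fstar` has small residuals rests on the Bellman equation for Q⋆, that is, on identifying the
sup-inf values with backward induction (`Vstar_eq_dpV`, `Qstar_eq_dpQ`). The min-player answers a
known μ, so near-optimal measurable policies are enough and no minimax theorem is needed. -/

lemma continuous_payoff (M : A → B → ℝ) (x : A → ℝ) : Continuous (payoff M x) := by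
  unfold payoff; fun_prop

lemma bddBelow_payoff (M : A → B → ℝ) (x : A → ℝ) :
    BddBelow (Set.range fun y : stdSimplex ℝ B => payoff M x (y : B → ℝ)) :=
  (isCompact_range ((continuous_payoff M x).comp continuous_subtype_val)).bddBelow

lemma guaranteed_le_payoff (M : A → B → ℝ) (x : A → ℝ) {y : B → ℝ} (hy : y ∈ stdSimplex ℝ B) :
    guaranteed M x ≤ payoff M x y :=
  ciInf_le (bddBelow_payoff M x) ⟨y, hy⟩

lemma payoff_le_payoff_add {M M' : A → B → ℝ} {ε : ℝ} (h : ∀ a b, M a b ≤ M' a b + ε)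
    {x : A → ℝ} (hx : x ∈ stdSimplex ℝ A) {y : B → ℝ} (hy : y ∈ stdSimplex ℝ B) :
    payoff M x y ≤ payoff M' x y + ε := by
  have hε : ε = ∑ a, ∑ b, x a * ε * y b := by
    simp_rw [← Finset.mul_sum, hy.2, mul_one, ← Finset.sum_mul, hx.2, one_mul]
  rw [hε]
  unfold payoff
  rw [← Finset.sum_add_distrib]
  refine Finset.sum_le_sum fun a _ => ?_
  rw [← Finset.sum_add_distrib]
  refine Finset.sum_le_sum fun b _ => ?_
  rw [← add_mul, ← mul_add]
  exact mul_le_mul_of_nonneg_right (mul_le_mul_of_nonneg_left (h a b) (hx.1 a)) (hy.1 b)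

lemma payoff_eq_sum (M : A → B → ℝ) (x : A → ℝ) (y : B → ℝ) :
    payoff M x y = ∑ b, (∑ a, x a * M a b) * y b := by
  unfold payoff
  rw [Finset.sum_comm]
  simp_rw [Finset.sum_mul]

lemma exists_matrixValue_sub_lt [Nonempty A] (M : A → B → ℝ) {ε : ℝ} (hε : 0 < ε) :
    ∃ x ∈ stdSimplex ℝ A, matrixValue M - ε < guaranteed M x := by
  obtain ⟨x, hx⟩ := exists_lt_of_lt_ciSup (f := fun x : stdSimplex ℝ A => guaranteed M (x : A → ℝ))
    (show matrixValue M - ε < _ from sub_lt_self _ hε)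
  exact ⟨x, x.2, hx⟩

variable [Nonempty B]

/-- A linear function on a simplex is minimal at a vertex. The infimum becomes one over finitely
many actions, which yields continuity and measurability. -/
lemma guaranteed_eq_iInf (M : A → B → ℝ) (x : A → ℝ) :
    guaranteed M x = ⨅ b, ∑ a, x a * M a b := by
  classical
  apply le_antisymm
  · refine le_ciInf fun b => ?_
    refine (guaranteed_le_payoff M x (single_mem_stdSimplex ℝ b)).trans_eq ?_
    rw [payoff_eq_sum]
    simp [Pi.single_apply]
  · refine le_ciInf fun y => ?_
    rw [payoff_eq_sum]
    calc ⨅ b, ∑ a, x a * M a b = ∑ b, (⨅ b, ∑ a, x a * M a b) * y.1 b := by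
          rw [← Finset.mul_sum, y.2.2, mul_one]
      _ ≤ _ := Finset.sum_le_sum fun b _ =>
          mul_le_mul_of_nonneg_right (ciInf_le (Set.finite_range _).bddBelow b) (y.2.1 b)

lemma continuous_guaranteed (M : A → B → ℝ) : Continuous (guaranteed M) := by
  have : guaranteed M = fun x => Finset.univ.inf' Finset.univ_nonempty
      fun b => ∑ a, x a * M a b := by
    funext x
    rw [guaranteed_eq_iInf, Finset.inf'_univ_eq_ciInf]
  rw [this]
  exact Continuous.finset_inf'_apply _ fun b _ => by fun_prop

lemma guaranteed_le_guaranteed_add {M M' : A → B → ℝ} {ε : ℝ} (h : ∀ a b, M a b ≤ M' a b + ε)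
    {x : A → ℝ} (hx : x ∈ stdSimplex ℝ A) : guaranteed M x ≤ guaranteed M' x + ε := by
  rw [← sub_le_iff_le_add]
  refine le_ciInf fun y => ?_
  rw [sub_le_iff_le_add]
  exact (guaranteed_le_payoff M x y.2).trans (payoff_le_payoff_add h hx y.2)

lemma bddAbove_guaranteed (M : A → B → ℝ) :
    BddAbove (Set.range fun x : stdSimplex ℝ A => guaranteed M (x : A → ℝ)) :=
  (isCompact_range ((continuous_guaranteed M).comp continuous_subtype_val)).bddAbove

lemma guaranteed_le_matrixValue (M : A → B → ℝ) {x : A → ℝ} (hx : x ∈ stdSimplex ℝ A) :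
    guaranteed M x ≤ matrixValue M :=
  le_ciSup (bddAbove_guaranteed M) ⟨x, hx⟩

lemma measurable_guaranteed {S : Type*} [MeasurableSpace S] {M : S → A → B → ℝ}
    (hM : ∀ a b, Measurable fun s => M s a b)
    {x : S → A → ℝ} (hx : ∀ a, Measurable fun s => x s a) :
    Measurable fun s => guaranteed (M s) (x s) := by
  simp_rw [guaranteed_eq_iInf]
  exact Measurable.iInf fun b => Finset.measurable_sum _ fun a _ => (hx a).mul (hM a b)

variable [Nonempty A]

lemma matrixValue_le_matrixValue_add {M M' : A → B → ℝ} {ε : ℝ}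
    (h : ∀ a b, M a b ≤ M' a b + ε) : matrixValue M ≤ matrixValue M' + ε := by
  refine ciSup_le fun x => (guaranteed_le_guaranteed_add h x.2).trans ?_
  have := guaranteed_le_matrixValue M' x.2
  linarith

/-- This Lipschitz bound makes induced value functions measurable and carries an approximation of Q⋆
over to V⋆. -/
lemma abs_matrixValue_sub_le {M M' : A → B → ℝ} {ε : ℝ}
    (h : ∀ a b, |M a b - M' a b| ≤ ε) : |matrixValue M - matrixValue M'| ≤ ε := by
  have h1 : matrixValue M ≤ matrixValue M' + ε :=
    matrixValue_le_matrixValue_add fun a b => by linarith [abs_le.1 (h a b)]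
  have h2 : matrixValue M' ≤ matrixValue M + ε :=
    matrixValue_le_matrixValue_add fun a b => by linarith [abs_le.1 (h a b)]
  rw [abs_le]
  constructor <;> linarith

lemma matrixValue_zero : matrixValue (fun (_ : A) (_ : B) => (0 : ℝ)) = 0 := by
  simp [matrixValue, guaranteed, payoff]

lemma matrixValue_nonneg {M : A → B → ℝ} (h : ∀ a b, 0 ≤ M a b) : 0 ≤ matrixValue M := by
  have := matrixValue_le_matrixValue_add (M := fun _ _ => 0) (M' := M) (ε := 0)
    (fun a b => by simpa using h a b)
  rwa [matrixValue_zero, add_zero] at this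

lemma matrixValue_le {M : A → B → ℝ} {c : ℝ} (h : ∀ a b, M a b ≤ c) : matrixValue M ≤ c := by
  have := matrixValue_le_matrixValue_add (M := M) (M' := fun _ _ => 0) (ε := c)
    (fun a b => by simpa using h a b)
  rwa [matrixValue_zero, zero_add] at this

lemma continuous_matrixValue : Continuous (matrixValue : (A → B → ℝ) → ℝ) := by
  refine (LipschitzWith.of_dist_le_mul (K := 1) fun M M' => ?_).continuous
  rw [NNReal.coe_one, one_mul, Real.dist_eq]
  refine abs_matrixValue_sub_le fun a b => ?_
  rw [← Real.dist_eq]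
  exact (dist_le_pi_dist (M a) (M' a) b).trans (dist_le_pi_dist M M' a)

variable {S : Type*} [MeasurableSpace S]

lemma measurable_matrixValue {M : S → A → B → ℝ} (hM : ∀ a b, Measurable fun s => M s a b) :
    Measurable fun s => matrixValue (M s) :=
  continuous_matrixValue.measurable.comp
    (measurable_pi_lambda _ fun a => measurable_pi_lambda _ fun b => hM a b)

end MatrixGame

/-! ### Measurable selection of mixed actions. -/

section Selection

variable {S D : Type*} [MeasurableSpace S] [Fintype D] [Nonempty D] [MeasurableSpace D]
  [MeasurableSingletonClass D]

/-- Mixed actions that strictly satisfy a continuous constraint can be chosen measurably. -/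
lemma exists_kernel_lt (φ : S → (D → ℝ) → ℝ) (t : S → ℝ) (hφ : ∀ x, Measurable fun s => φ s x)
    (ht : Measurable t) (hc : ∀ s, Continuous (φ s))
    (hex : ∀ s, ∃ x ∈ stdSimplex ℝ D, t s < φ s x) :
    ∃ κ : Kernel S D, IsMarkovKernel κ ∧ ∀ s, t s < φ s (fun a => (κ s).real {a}) := by
  classical
  -- The constraint is open, so some member of a fixed dense sequence satisfies it; taking the first
  -- such index is a measurable choice. This is why strict inequalities, hence near-optimal rather
  -- than optimal actions, are used.
  let x : ℕ → D → ℝ := fun n => (TopologicalSpace.denseSeq (stdSimplex ℝ D) n).1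
  have hxm : ∀ n, x n ∈ stdSimplex ℝ D := fun n => (TopologicalSpace.denseSeq (stdSimplex ℝ D) n).2
  have hx : ∀ s, ∃ n, t s < φ s (x n) := by
    intro s
    obtain ⟨y, hy, hlt⟩ := hex s
    have ho : IsOpen {z : stdSimplex ℝ D | t s < φ s z.1} :=
      isOpen_lt continuous_const ((hc s).comp continuous_subtype_val)
    exact (TopologicalSpace.denseRange_denseSeq (stdSimplex ℝ D)).exists_mem_open
      ho ⟨⟨y, hy⟩, hlt⟩
  let N : S → ℕ := fun s => Nat.find (hx s)
  have hN : Measurable N := measurable_find hx fun n => measurableSet_lt ht (hφ _)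
  let m : ℕ → Measure D := fun n => ∑ a, ENNReal.ofReal (x n a) • Measure.dirac a
  have hm : ∀ n a, m n {a} = ENNReal.ofReal (x n a) := by
    intro n a
    simp [m, Measure.finsetSum_apply, Set.indicator_apply]
  have hm1 : ∀ n, m n Set.univ = 1 := by
    intro n
    simp only [m, Measure.finsetSum_apply, Measure.smul_apply, measure_univ, smul_eq_mul, mul_one]
    rw [← ENNReal.ofReal_sum_of_nonneg fun a _ => (hxm n).1 a, (hxm n).2, ENNReal.ofReal_one]
  refine ⟨(Kernel.ofFunOfCountable m).comap N hN, ⟨fun s => ⟨hm1 (N s)⟩⟩, fun s => ?_⟩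
  have : (fun a => (((Kernel.ofFunOfCountable m).comap N hN) s).real {a}) = x (N s) := by
    funext a
    change ((m (N s)) {a}).toReal = _
    rw [hm, ENNReal.toReal_ofReal ((hxm (N s)).1 a)]
  rw [this]
  exact Nat.find_spec (hx s)

end Selection

lemma integrable_of_abs_le {X : Type*} [MeasurableSpace X] {m : Measure X} [IsFiniteMeasure m]
    {g : X → ℝ} (hg : Measurable g) {c : ℝ} (hc : ∀ x, |g x| ≤ c) : Integrable g m :=
  Integrable.of_bound hg.aestronglyMeasurable c (Filter.Eventually.of_forall hc)

lemma abs_integral_le_of_abs_le {X : Type*} [MeasurableSpace X] {m : Measure X}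
    [IsProbabilityMeasure m] {g : X → ℝ} {c : ℝ} (hc : ∀ x, |g x| ≤ c) : |∫ x, g x ∂m| ≤ c := by
  simpa using norm_integral_le_of_norm_le_const (μ := m) (f := g) (C := c)
    (Filter.Eventually.of_forall hc)

lemma measurable_integral_kernel {X Y : Type*} [MeasurableSpace X] [MeasurableSpace Y]
    (κ : Kernel X Y) [IsMarkovKernel κ] {g : Y → ℝ} (hg : Measurable g) :
    Measurable fun x => ∫ y, g y ∂κ x :=
  (StronglyMeasurable.integral_kernel hg.stronglyMeasurable).measurable

/-! ### Integration along rollouts. -/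

section Rollout

variable {S Z : Type*} [MeasurableSpace S] [MeasurableSpace Z]

lemma measurable_fin_cons {n : ℕ} :
    Measurable (fun w : Z × (Fin n → Z) => (Fin.cons w.1 w.2 : Fin (n + 1) → Z)) := by
  refine measurable_pi_iff.2 fun i => ?_
  refine Fin.cases ?_ (fun j => ?_) i
  · simpa using measurable_fst
  · simpa [Function.comp_def] using
      (measurable_pi_apply j).comp (measurable_snd (α := Z) (β := Fin n → Z))

lemma measurable_fin_cons_right {n : ℕ} (z : Z) :
    Measurable (fun w : Fin n → Z => (Fin.cons z w : Fin (n + 1) → Z)) :=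
  measurable_fin_cons.comp (measurable_const.prodMk measurable_id)

instance isMarkovKernel_rollout {n : ℕ} (κ : Fin n → Kernel S Z) (p : Fin n → Kernel Z S)
    [hκ : ∀ i, IsMarkovKernel (κ i)] [hp : ∀ i, IsMarkovKernel (p i)] :
    IsMarkovKernel (rollout κ p) := by
  induction n with
  | zero => rw [rollout]; infer_instance
  | succ n ih =>
    have := ih (fun i => κ i.succ) (fun i => p i.succ)
    rw [rollout]
    exact Kernel.IsMarkovKernel.map _ measurable_fin_cons

variable {n : ℕ} (κ : Fin (n + 1) → Kernel S Z) (p : Fin (n + 1) → Kernel Z S)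
  [hκ : ∀ i, IsMarkovKernel (κ i)] [hp : ∀ i, IsMarkovKernel (p i)]

lemma lintegral_rollout_succ {Φ : (Fin (n + 1) → Z) → ℝ≥0∞} (hΦ : Measurable Φ) (s : S) :
    ∫⁻ τ, Φ τ ∂(rollout κ p s) =
      ∫⁻ z, ∫⁻ s', ∫⁻ τ, Φ (Fin.cons z τ)
        ∂(rollout (fun i : Fin n => κ i.succ) (fun i => p i.succ) s') ∂(p 0 z) ∂(κ 0 s) := by
  have hΦ' : Measurable fun w : Z × (Fin n → Z) => Φ (Fin.cons w.1 w.2) :=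
    hΦ.comp measurable_fin_cons
  rw [rollout, Kernel.lintegral_map _ measurable_fin_cons _ hΦ, Kernel.lintegral_compProd _ _ _ hΦ']
  refine lintegral_congr fun z => ?_
  have hΦz : Measurable fun τ : Fin n → Z => Φ (Fin.cons z τ) :=
    hΦ.comp (measurable_fin_cons_right z)
  rw [Kernel.prodMkLeft_apply]
  exact Kernel.lintegral_comp _ _ _ hΦz

lemma integral_rollout_succ {Φ : (Fin (n + 1) → Z) → ℝ} (hΦ : Measurable Φ) {c : ℝ}
    (hc : ∀ τ, |Φ τ| ≤ c) (s : S) :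
    ∫ τ, Φ τ ∂(rollout κ p s) =
      ∫ z, ∫ s', ∫ τ, Φ (Fin.cons z τ)
        ∂(rollout (fun i : Fin n => κ i.succ) (fun i => p i.succ) s') ∂(p 0 z) ∂(κ 0 s) := by
  have hΦ' : Measurable fun w : Z × (Fin n → Z) => Φ (Fin.cons w.1 w.2) :=
    hΦ.comp measurable_fin_cons
  rw [rollout, Kernel.map_apply _ measurable_fin_cons,
    integral_map measurable_fin_cons.aemeasurable hΦ.aestronglyMeasurable,
    integral_compProd (integrable_of_abs_le hΦ' fun w => hc _)]
  refine integral_congr_ae (Filter.Eventually.of_forall fun z => ?_)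
  dsimp only
  have hΦz : Measurable fun τ : Fin n → Z => Φ (Fin.cons z τ) :=
    hΦ.comp (measurable_fin_cons_right z)
  rw [Kernel.prodMkLeft_apply]
  exact Kernel.integral_comp (integrable_of_abs_le hΦz fun w => hc _)

/-- Bellman recursion for the expected sum of bounded functions along a rollout. -/
lemma integral_rollout_sum_succ {ρ : Fin (n + 1) → Z → ℝ} (hρ : ∀ i, Measurable (ρ i)) {c : ℝ}
    (hc : ∀ i z, |ρ i z| ≤ c) (s : S) :
    ∫ τ, ∑ i, ρ i (τ i) ∂(rollout κ p s) =
      ∫ z, (ρ 0 z + ∫ s', ∫ τ, ∑ i : Fin n, ρ i.succ (τ i)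
        ∂(rollout (fun i : Fin n => κ i.succ) (fun i => p i.succ) s') ∂(p 0 z)) ∂(κ 0 s) := by
  have hb : ∀ {m : ℕ} (g : Fin m → ℝ), (∀ i, |g i| ≤ c) → |∑ i, g i| ≤ m * c := by
    intro m g hg
    refine (Finset.abs_sum_le_sum_abs _ _).trans ((Finset.sum_le_sum fun i _ => hg i).trans ?_)
    simp
  have hm : ∀ {m : ℕ} (g : Fin m → Z → ℝ), (∀ i, Measurable (g i)) →
      Measurable fun τ : Fin m → Z => ∑ i, g i (τ i) := fun g hg =>
    Finset.measurable_sum _ fun i _ => (hg i).comp (measurable_pi_apply i)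
  rw [integral_rollout_succ κ p (hm ρ hρ) (c := (n + 1 : ℕ) * c) (fun τ => hb _ fun i => hc _ _)]
  refine integral_congr_ae (Filter.Eventually.of_forall fun z => ?_)
  dsimp only
  have h1 : ∀ s', ∫ τ, ∑ i : Fin (n + 1), ρ i ((Fin.cons z τ : Fin (n + 1) → Z) i)
        ∂(rollout (fun i : Fin n => κ i.succ) (fun i => p i.succ) s') =
      ρ 0 z + ∫ τ, ∑ i : Fin n, ρ i.succ (τ i)
        ∂(rollout (fun i : Fin n => κ i.succ) (fun i => p i.succ) s') := by
    intro s'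
    simp_rw [Fin.sum_univ_succ, Fin.cons_zero, Fin.cons_succ]
    rw [integral_add (integrable_const _) (integrable_of_abs_le (hm _ fun i => hρ _)
      (fun τ => hb _ fun i => hc _ _))]
    simp
  simp_rw [h1]
  rw [integral_add (integrable_const _) (integrable_of_abs_le (measurable_integral_kernel _
    (hm _ fun i => hρ _)) (fun s' => abs_integral_le_of_abs_le (fun τ => hb _ fun i => hc _ _)))]
  simp

/-- A function of one step and the state that follows it, whose mean is at most `1` under the
transition kernel, has mean at most `1` under the rollout. -/
lemma lintegral_rollout_transition_le {st : Z → S} (hst : Measurable st) {m : ℕ}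
    (κ : Fin m → Kernel S Z) (p : Fin m → Kernel Z S)
    [hκ : ∀ i, IsMarkovKernel (κ i)] [hp : ∀ i, IsMarkovKernel (p i)]
    (hκst : ∀ i s, (κ i s).map st = Measure.dirac s) (i : ℕ) (hi : i + 1 < m)
    {Ψ : Z × S → ℝ≥0∞} (hΨ : Measurable Ψ)
    (h1 : ∀ z, ∫⁻ s', Ψ (z, s') ∂(p ⟨i, by omega⟩ z) ≤ 1) (s : S) :
    ∫⁻ τ, Ψ (τ ⟨i, by omega⟩, st (τ ⟨i + 1, hi⟩)) ∂(rollout κ p s) ≤ 1 := by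
  induction m generalizing i s with
  | zero => omega
  | succ m ih =>
    have hΦ : Measurable fun τ : Fin (m + 1) → Z => Ψ (τ ⟨i, by omega⟩, st (τ ⟨i + 1, hi⟩)) :=
      hΨ.comp ((measurable_pi_apply _).prodMk (hst.comp (measurable_pi_apply _)))
    rw [lintegral_rollout_succ κ p hΦ]
    have hone : ∫⁻ _, (1 : ℝ≥0∞) ∂(κ 0 s) = 1 := by simp
    rw [← hone]
    refine lintegral_mono fun z => ?_
    obtain _ | i := i
    · refine le_trans (lintegral_mono fun s' => ?_) (h1 z)
      obtain _ | m := m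
      · omega
      have hcons : ∀ τ : Fin (m + 1) → Z,
          (Fin.cons z τ : Fin (m + 2) → Z) ⟨0 + 1, hi⟩ = τ 0 := fun τ => rfl
      have hcons0 : ∀ τ : Fin (m + 1) → Z,
          (Fin.cons z τ : Fin (m + 2) → Z) ⟨0, by omega⟩ = z := fun τ => rfl
      simp_rw [hcons, hcons0]
      have hΨz : Measurable fun s' => Ψ (z, s') := hΨ.comp measurable_prodMk_left
      have hΨz' : Measurable fun τ : Fin (m + 1) → Z => Ψ (z, st (τ 0)) :=
        hΨz.comp (hst.comp (measurable_pi_apply 0))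
      rw [lintegral_rollout_succ _ _ hΨz']
      simp only [Fin.cons_zero, lintegral_const, measure_univ, mul_one]
      -- The step kernel keeps the state it starts from, so the state read off the next step is `s'`
      -- itself.
      rw [← lintegral_map hΨz hst, hκst, lintegral_dirac' _ hΨz]
    · have hone' : ∫⁻ _, (1 : ℝ≥0∞) ∂(p 0 z) = 1 := by simp
      rw [← hone']
      refine lintegral_mono fun s' => ?_
      exact ih (fun j => κ j.succ) (fun j => p j.succ) (fun j s => hκst j.succ s) i (by omega)
        h1 s'

end Rollout

/-! ### The law of a single step. -/

section StepKernel

variable {H : ℕ} {S A B : Type*} [MeasurableSpace S] [MeasurableSpace A] [MeasurableSpace B]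

instance isMarkovKernel_ker (μ : Policy H S A) (h : Fin H) : IsMarkovKernel (μ.ker h) :=
  μ.markov h

instance isMarkovKernel_trans (M : Game H S A B) (h : Fin H) : IsMarkovKernel (M.trans h) :=
  M.trans_markov h

instance isMarkovKernel_stepKer (μ : Policy H S A) (ν : Policy H S B) (h : Fin H) :
    IsMarkovKernel (stepKer μ ν h) := by
  unfold stepKer; infer_instance

instance isMarkovKernel_rolloutFrom (M : Game H S A B) (μ : Policy H S A) (ν : Policy H S B)
    (h : ℕ) : IsMarkovKernel (M.rolloutFrom μ ν h) := by
  unfold Game.rolloutFrom; infer_instance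

instance isProbabilityMeasure_episodeLaw (M : Game H S A B) (μ : Policy H S A)
    (ν : Policy H S B) : IsProbabilityMeasure (M.episodeLaw μ ν) := by
  unfold Game.episodeLaw; infer_instance

lemma stepKer_apply (μ : Policy H S A) (ν : Policy H S B) (h : Fin H) (s : S) :
    stepKer μ ν h s = ((μ.ker h s).prod (ν.ker h s)).map (Prod.mk s) := by
  unfold stepKer
  rw [Kernel.prod_apply, Kernel.id_apply, Kernel.prod_apply, Measure.dirac_prod]

lemma map_fst_stepKer (μ : Policy H S A) (ν : Policy H S B) (h : Fin H) (s : S) :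
    (stepKer μ ν h s).map Prod.fst = Measure.dirac s := by
  rw [stepKer_apply, Measure.map_map measurable_fst measurable_prodMk_left]
  have : (Prod.fst ∘ Prod.mk s : A × B → S) = fun _ => s := rfl
  rw [this, Measure.map_const]
  simp

variable [Fintype A] [MeasurableSingletonClass A] [Fintype B] [MeasurableSingletonClass B]

lemma probs_mem_stdSimplex (μ : Policy H S A) (h : Fin H) (s : S) :
    μ.probs h s ∈ stdSimplex ℝ A := by
  refine ⟨fun a => measureReal_nonneg, ?_⟩
  unfold Policy.probs
  rw [sum_measureReal_singleton]
  simp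

lemma integral_stepKer (μ : Policy H S A) (ν : Policy H S B) (h : Fin H) (s : S)
    {g : S × A × B → ℝ} (hg : Measurable g) :
    ∫ z, g z ∂(stepKer μ ν h s) =
      payoff (fun a b => g (s, a, b)) (μ.probs h s) (ν.probs h s) := by
  rw [stepKer_apply, integral_map measurable_prodMk_left.aemeasurable hg.aestronglyMeasurable,
    integral_fintype Integrable.of_finite, Fintype.sum_prod_type]
  unfold payoff Policy.probs
  refine Finset.sum_congr rfl fun a _ => Finset.sum_congr rfl fun b _ => ?_
  rw [← Set.singleton_prod_singleton, measureReal_prod_prod, smul_eq_mul]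
  ring

end StepKernel

/-! ### Values of fixed policy pairs and their Bellman recursion. -/

namespace Game

variable {H : ℕ} {S A B : Type*} [MeasurableSpace S] [MeasurableSpace A] [MeasurableSpace B]
variable (M : Game H S A B)

/-- Expected sum, from step `h` on, of the quantities `ρ` along the trajectory. -/
def valueOf (ρ : Fin H → S × A × B → ℝ) (μ : Policy H S A) (ν : Policy H S B) (h : ℕ) (s : S) :
    ℝ :=
  ∫ τ, ∑ i : Fin (H - h), ρ ⟨h + i, by omega⟩ (τ i) ∂(M.rolloutFrom μ ν h s)

lemma V_eq_valueOf (μ : Policy H S A) (ν : Policy H S B) (h : ℕ) (s : S) :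
    M.V μ ν h s = M.valueOf M.reward μ ν h s := rfl

variable (μ : Policy H S A) (ν : Policy H S B)

lemma valueOf_of_le (ρ : Fin H → S × A × B → ℝ) {h : ℕ} (hh : H ≤ h) (s : S) :
    M.valueOf ρ μ ν h s = 0 := by
  have : IsEmpty (Fin (H - h)) := by
    rw [Nat.sub_eq_zero_of_le hh]; infer_instance
  simp [valueOf]

/-- Trajectories from step `h` have the dependent type `Fin (H - h) → _`; a free length `n` lets the
recursion recognise a successor. -/
lemma valueOf_eq_of_eq (ρ : Fin H → S × A × B → ℝ) {h n : ℕ} (hn : H - h = n) (s : S) :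
    M.valueOf ρ μ ν h s =
      ∫ τ : Fin n → S × A × B, ∑ i : Fin n, ρ ⟨h + i, by omega⟩ (τ i)
        ∂(rollout (fun i : Fin n => stepKer μ ν ⟨h + i, by omega⟩)
          (fun i : Fin n => M.trans ⟨h + i, by omega⟩) s) := by
  subst hn
  rfl

lemma valueOf_zero_init (ρ : Fin H → S × A × B → ℝ) :
    M.valueOf ρ μ ν 0 M.init = ∫ τ, ∑ h, ρ h (τ h) ∂(M.episodeLaw μ ν) := by
  rw [valueOf_eq_of_eq M μ ν ρ (n := H) (by omega)]
  unfold episodeLaw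
  simp only [zero_add, Fin.eta]

variable {M μ ν} {ρ : Fin H → S × A × B → ℝ} {c : ℝ}

lemma valueOf_step (hρ : ∀ h, Measurable (ρ h)) (hc : ∀ h z, |ρ h z| ≤ c) {h : ℕ} (hh : h < H)
    (s : S) :
    M.valueOf ρ μ ν h s =
      ∫ z, (ρ ⟨h, hh⟩ z + ∫ s', M.valueOf ρ μ ν (h + 1) s' ∂(M.trans ⟨h, hh⟩ z))
        ∂(stepKer μ ν ⟨h, hh⟩ s) := by
  rw [valueOf_eq_of_eq M μ ν ρ (n := (H - (h + 1)) + 1) (by omega)]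
  rw [integral_rollout_sum_succ _ _ (fun i => hρ _) (fun i z => hc _ z)]
  unfold valueOf rolloutFrom
  have e : ∀ i : Fin (H - (h + 1)), (⟨h + (i.succ : Fin _), by simp; omega⟩ : Fin H) =
      ⟨h + 1 + i, by omega⟩ := fun i => Fin.ext (by simp; omega)
  simp only [Fin.val_zero, add_zero, e]

lemma measurable_valueOf (hρ : ∀ h, Measurable (ρ h)) (h : ℕ) :
    Measurable (M.valueOf ρ μ ν h) :=
  measurable_integral_kernel _ (Finset.measurable_sum _ fun i _ =>
    (hρ _).comp (measurable_pi_apply i))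

lemma abs_valueOf_le (hc : ∀ h z, |ρ h z| ≤ c) (h : ℕ) (s : S) :
    |M.valueOf ρ μ ν h s| ≤ (H - h : ℕ) * c := by
  refine abs_integral_le_of_abs_le fun τ => ?_
  refine (Finset.abs_sum_le_sum_abs _ _).trans ((Finset.sum_le_sum fun i _ => hc _ _).trans ?_)
  simp

lemma valueOf_nonneg (hρ : ∀ h z, 0 ≤ ρ h z) (h : ℕ) (s : S) : 0 ≤ M.valueOf ρ μ ν h s :=
  integral_nonneg fun _ => Finset.sum_nonneg fun _ _ => hρ _ _

lemma valueOf_neg (h : ℕ) (s : S) :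
    M.valueOf (fun h z => -ρ h z) μ ν h s = -M.valueOf ρ μ ν h s := by
  simp only [valueOf, Finset.sum_neg_distrib, integral_neg]

lemma valueOf_add {ρ' : Fin H → S × A × B → ℝ} {c' : ℝ}
    (hρ : ∀ h, Measurable (ρ h)) (hc : ∀ h z, |ρ h z| ≤ c)
    (hρ' : ∀ h, Measurable (ρ' h)) (hc' : ∀ h z, |ρ' h z| ≤ c') (h : ℕ) (s : S) :
    M.valueOf (fun h z => ρ h z + ρ' h z) μ ν h s =
      M.valueOf ρ μ ν h s + M.valueOf ρ' μ ν h s := by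
  have hi : ∀ {σ : Fin H → S × A × B → ℝ} {b : ℝ}, (∀ h, Measurable (σ h)) →
      (∀ h z, |σ h z| ≤ b) → Integrable (fun τ : Fin (H - h) → S × A × B =>
        ∑ i : Fin (H - h), σ ⟨h + i, by omega⟩ (τ i)) (M.rolloutFrom μ ν h s) :=
    fun hσ hb => integrable_finsetSum _ fun i _ =>
      integrable_of_abs_le ((hσ _).comp (measurable_pi_apply i)) fun τ => hb _ _
  simp only [valueOf, Finset.sum_add_distrib]
  exact integral_add (hi hρ hc) (hi hρ' hc')

lemma valueOf_const (c : ℝ) (h : ℕ) (s : S) :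
    M.valueOf (fun _ _ => c) μ ν h s = (H - h : ℕ) * c := by
  simp [valueOf]

/-- Comparison principle: a subsolution of the Bellman recursion lies below the value. -/
lemma le_valueOf (hρ : ∀ h, Measurable (ρ h)) (hc : ∀ h z, |ρ h z| ≤ c)
    {W : ℕ → S → ℝ} (hW : ∀ h, Measurable (W h)) {C : ℝ} (hC : ∀ h s, |W h s| ≤ C)
    (hend : ∀ s, W H s ≤ 0)
    (hstep : ∀ h (hh : h < H) s, W h s ≤
      ∫ z, (ρ ⟨h, hh⟩ z + ∫ s', W (h + 1) s' ∂(M.trans ⟨h, hh⟩ z)) ∂(stepKer μ ν ⟨h, hh⟩ s))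
    {h : ℕ} (hh : h ≤ H) (s : S) : W h s ≤ M.valueOf ρ μ ν h s := by
  induction hh using Nat.decreasingInduction generalizing s with
  | self => rw [valueOf_of_le M μ ν ρ le_rfl]; exact hend s
  | of_succ h hh ih =>
    rw [valueOf_step hρ hc hh]
    refine (hstep h hh s).trans ?_
    have hv := abs_valueOf_le (M := M) (μ := μ) (ν := ν) hc (h + 1)
    have hvm := measurable_valueOf (M := M) (μ := μ) (ν := ν) hρ (h + 1)
    refine integral_mono ?_ ?_ fun z => ?_
    · exact (integrable_of_abs_le (hρ _) (hc _)).add (integrable_of_abs_le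
        (measurable_integral_kernel _ (hW _)) fun z => abs_integral_le_of_abs_le (hC _))
    · exact (integrable_of_abs_le (hρ _) (hc _)).add (integrable_of_abs_le
        (measurable_integral_kernel _ hvm) fun z => abs_integral_le_of_abs_le hv)
    · dsimp only
      have := integral_mono (μ := M.trans ⟨h, hh⟩ z) (integrable_of_abs_le (hW _) (hC _))
        (integrable_of_abs_le hvm hv) ih
      linarith

/-- Comparison principle: a supersolution of the Bellman recursion lies above the value. -/
lemma valueOf_le (hρ : ∀ h, Measurable (ρ h)) (hc : ∀ h z, |ρ h z| ≤ c)
    {W : ℕ → S → ℝ} (hW : ∀ h, Measurable (W h)) {C : ℝ} (hC : ∀ h s, |W h s| ≤ C)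
    (hend : ∀ s, 0 ≤ W H s)
    (hstep : ∀ h (hh : h < H) s,
      ∫ z, (ρ ⟨h, hh⟩ z + ∫ s', W (h + 1) s' ∂(M.trans ⟨h, hh⟩ z)) ∂(stepKer μ ν ⟨h, hh⟩ s) ≤ W h s)
    {h : ℕ} (hh : h ≤ H) (s : S) : M.valueOf ρ μ ν h s ≤ W h s := by
  have := le_valueOf (M := M) (μ := μ) (ν := ν) (ρ := fun h z => -ρ h z) (c := c)
    (fun h => (hρ h).neg) (fun h z => by rw [abs_neg]; exact hc h z) (W := fun h s => -W h s)
    (fun h => (hW h).neg) (C := C) (fun h z => by rw [abs_neg]; exact hC h z)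
    (fun s => by simpa using hend s) (fun h hh s => ?_) hh s
  · rw [valueOf_neg] at this; linarith
  · simp only [integral_neg, ← neg_add]
    rw [neg_le_neg_iff]
    exact hstep h hh s

end Game

/-! ### Nash values by backward induction. -/

namespace Game

variable {H : ℕ} {S A B : Type*} [MeasurableSpace S] [MeasurableSpace A] [MeasurableSpace B]

/-- The game bounds rewards only almost surely along played trajectories, which says nothing at
unreachable states. A pointwise bound `R` is therefore carried along; `reward_le` later supplies it
from completeness. -/
lemma abs_reward_le {M : Game H S A B} {R : ℝ} (hR : ∀ h z, M.reward h z ≤ R)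
    (h : Fin H) (z : S × A × B) :
    |M.reward h z| ≤ R := by
  rw [abs_of_nonneg (M.reward_nonneg h z)]; exact hR h z

section

variable {M : Game H S A B} {R : ℝ}

lemma measurable_probs [MeasurableSingletonClass A] (μ : Policy H S A) (h : Fin H) (a : A) :
    Measurable fun s => μ.probs h s a :=
  (Kernel.measurable_coe (μ.ker h) (measurableSet_singleton a)).ennreal_toReal

lemma valueOf_reward_add (hR : ∀ h z, M.reward h z ≤ R) (μ : Policy H S A) (ν : Policy H S B)
    (ε : ℝ) (h : ℕ) (s : S) :
    M.valueOf (fun h z => M.reward h z + ε) μ ν h s = M.V μ ν h s + (H - h : ℕ) * ε := by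
  rw [valueOf_add M.reward_measurable (abs_reward_le hR) (ρ' := fun _ _ => ε) (c' := |ε|)
    (fun _ => measurable_const) (fun _ _ => le_rfl), valueOf_const, V_eq_valueOf]

lemma V_nonneg (μ : Policy H S A) (ν : Policy H S B) (h : ℕ) (s : S) : 0 ≤ M.V μ ν h s :=
  valueOf_nonneg M.reward_nonneg h s

lemma abs_V_le (hR0 : 0 ≤ R) (hR : ∀ h z, M.reward h z ≤ R) (μ : Policy H S A)
    (ν : Policy H S B) (h : ℕ) (s : S) : |M.V μ ν h s| ≤ H * R :=
  (abs_valueOf_le (abs_reward_le hR) h s).trans (mul_le_mul_of_nonneg_right (by simp) hR0)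

lemma measurable_V (μ : Policy H S A) (ν : Policy H S B) (h : ℕ) : Measurable (M.V μ ν h) :=
  measurable_valueOf M.reward_measurable h

lemma Q_eq (hR : ∀ h z, M.reward h z ≤ R) (μ : Policy H S A) (ν : Policy H S B) (h : Fin H)
    (z : S × A × B) :
    M.Q μ ν h z = M.reward h z + ∫ s', M.V μ ν (h + 1) s' ∂(M.trans h z) := by
  unfold Q
  rw [Kernel.integral_comp]
  · rfl
  · refine integrable_finsetSum _ fun i _ => ?_
    exact integrable_of_abs_le ((M.reward_measurable _).comp (measurable_pi_apply i))
      fun τ => abs_reward_le hR _ _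

end

variable [Fintype A] [Fintype B] (M : Game H S A B)

/-- Optimal value with `n` steps to go, by backward induction. -/
def valueToGo : ℕ → S → ℝ
  | 0, _ => 0
  | n + 1, s => if hn : n < H then
      -- With `n + 1` steps to go, the current step is `H - 1 - n` in the numbering from `0`.
      matrixValue (fun a b => M.reward ⟨H - 1 - n, by omega⟩ (s, a, b) +
        ∫ s', valueToGo n s' ∂(M.trans ⟨H - 1 - n, by omega⟩ (s, a, b)))
    else 0

/-- Optimal value from step `h` on, by backward induction. -/
def dpV (h : ℕ) (s : S) : ℝ := M.valueToGo (H - h) s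

/-- Optimal action value at step `h`, by backward induction. -/
def dpQ (h : Fin H) (z : S × A × B) : ℝ :=
  M.reward h z + ∫ s', M.dpV (h + 1) s' ∂(M.trans h z)

lemma dpV_of_le {h : ℕ} (hh : H ≤ h) (s : S) : M.dpV h s = 0 := by
  rw [dpV, Nat.sub_eq_zero_of_le hh]; rfl

lemma dpV_of_lt {h : ℕ} (hh : h < H) (s : S) :
    M.dpV h s = matrixValue (fun a b => M.dpQ ⟨h, hh⟩ (s, a, b)) := by
  have e : H - h = (H - (h + 1)) + 1 := by omega
  have e' : (⟨H - 1 - (H - (h + 1)), by omega⟩ : Fin H) = ⟨h, hh⟩ := Fin.ext (by simp; omega)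
  rw [dpV, e, valueToGo, dif_pos (by omega)]
  simp only [e', dpQ, dpV]

variable [Nonempty A] [Nonempty B]

lemma measurable_dpV (h : ℕ) : Measurable (M.dpV h) := by
  unfold dpV
  generalize H - h = n
  induction n with
  | zero => exact measurable_const
  | succ n ih =>
    unfold valueToGo
    split_ifs with hn
    · refine measurable_matrixValue fun a b => ?_
      have := (M.reward_measurable ⟨H - 1 - n, by omega⟩).add
        (measurable_integral_kernel (M.trans ⟨H - 1 - n, by omega⟩) ih)
      exact this.comp (measurable_id.prodMk measurable_const)
    · exact measurable_const

lemma measurable_dpQ (h : Fin H) : Measurable (M.dpQ h) :=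
  (M.reward_measurable h).add (measurable_integral_kernel _ (M.measurable_dpV _))

variable {M} {R : ℝ}

lemma abs_dpV_le (hR0 : 0 ≤ R) (hR : ∀ h z, M.reward h z ≤ R) (h : ℕ) (s : S) :
    |M.dpV h s| ≤ (H - h : ℕ) * R := by
  unfold dpV
  generalize H - h = n
  induction n generalizing s with
  | zero => simp [valueToGo]
  | succ n ih =>
    unfold valueToGo
    split_ifs with hn
    · have := abs_matrixValue_sub_le (M := fun a b => M.reward ⟨H - 1 - n, by omega⟩ (s, a, b) +
        ∫ s', M.valueToGo n s' ∂(M.trans ⟨H - 1 - n, by omega⟩ (s, a, b)))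
        (M' := fun _ _ => 0) (ε := (n + 1 : ℕ) * R) (fun a b => ?_)
      · rwa [matrixValue_zero, sub_zero] at this
      · rw [sub_zero, Nat.cast_succ, add_mul, one_mul, add_comm]
        exact (abs_add_le _ _).trans (add_le_add (abs_integral_le_of_abs_le ih)
          (abs_reward_le hR _ _) |>.trans' (by rw [add_comm]))
    · rw [abs_zero]; positivity

lemma measurable_dpQ_slice (h : Fin H) (a : A) (b : B) :
    Measurable fun s => M.dpQ h (s, a, b) :=
  (M.measurable_dpQ h).comp (measurable_id.prodMk measurable_const)

lemma abs_dpV_le' (hR0 : 0 ≤ R) (hR : ∀ h z, M.reward h z ≤ R) (h : ℕ) (s : S) :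
    |M.dpV h s| ≤ H * R :=
  (abs_dpV_le hR0 hR h s).trans (mul_le_mul_of_nonneg_right (by simp) hR0)

variable [MeasurableSingletonClass A] [MeasurableSingletonClass B]

/-- A max-player policy that secures the dynamic programming value up to `H * ε`. -/
lemma exists_policy_dpV_le (hR0 : 0 ≤ R) (hR : ∀ h z, M.reward h z ≤ R) {ε : ℝ} (hε : 0 < ε) :
    ∃ μ : Policy H S A, ∀ (ν : Policy H S B) (h : ℕ) (s : S),
      M.dpV h s ≤ M.V μ ν h s + H * ε := by
  have key : ∀ h : Fin H, ∃ κ : Kernel S A, IsMarkovKernel κ ∧ ∀ s,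
      matrixValue (fun a b => M.dpQ h (s, a, b)) - ε <
        guaranteed (fun a b => M.dpQ h (s, a, b)) (fun a => (κ s).real {a}) := fun h =>
    exists_kernel_lt (fun s x => guaranteed (fun a b => M.dpQ h (s, a, b)) x) _
      (fun x => measurable_guaranteed (measurable_dpQ_slice h) fun a => measurable_const)
      ((measurable_matrixValue (measurable_dpQ_slice h)).sub_const ε)
      (fun s => continuous_guaranteed _) (fun s => exists_matrixValue_sub_lt _ hε)
  choose κ hκ hlt using key
  refine ⟨⟨κ, hκ⟩, fun ν h s => ?_⟩
  set μ : Policy H S A := ⟨κ, hκ⟩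
  obtain hh | hh := le_total H h
  · rw [dpV_of_le M hh, V_eq_valueOf, valueOf_of_le M μ ν _ hh]; positivity
  -- Raising every reward by `ε` pays for the selection error of each step, so `dpV` becomes an
  -- exact subsolution for the raised rewards.
  have h1 : M.dpV h s ≤ M.valueOf (fun h z => M.reward h z + ε) μ ν h s := by
    refine le_valueOf (c := R + ε) (fun h => (M.reward_measurable h).add_const ε)
      (fun h z => (abs_add_le _ _).trans (add_le_add (abs_reward_le hR h z) (abs_of_pos hε).le))
      M.measurable_dpV (abs_dpV_le' hR0 hR) (fun s => (dpV_of_le M le_rfl s).le) ?_ hh s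
    intro h hh s
    have h2 : ∀ z, M.reward ⟨h, hh⟩ z + ε + ∫ s', M.dpV (h + 1) s' ∂(M.trans ⟨h, hh⟩ z) =
        M.dpQ ⟨h, hh⟩ z + ε := fun z => by rw [dpQ]; ring
    simp_rw [h2]
    rw [integral_stepKer _ _ _ _ ((M.measurable_dpQ _).add_const ε), dpV_of_lt M hh]
    have h3 := hlt ⟨h, hh⟩ s
    have h4 := guaranteed_le_guaranteed_add (M := fun a b => M.dpQ ⟨h, hh⟩ (s, a, b))
      (M' := fun a b => M.dpQ ⟨h, hh⟩ (s, a, b) + ε) (ε := -ε) (fun a b => by simp)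
      (probs_mem_stdSimplex μ ⟨h, hh⟩ s)
    have h5 := guaranteed_le_payoff (fun a b => M.dpQ ⟨h, hh⟩ (s, a, b) + ε)
      (μ.probs ⟨h, hh⟩ s) (probs_mem_stdSimplex ν ⟨h, hh⟩ s)
    have h6 : guaranteed (fun a b => M.dpQ ⟨h, hh⟩ (s, a, b)) (μ.probs ⟨h, hh⟩ s) =
      guaranteed (fun a b => M.dpQ ⟨h, hh⟩ (s, a, b)) fun a => (κ ⟨h, hh⟩ s).real {a} := rfl
    linarith
  rw [valueOf_reward_add hR] at h1
  refine h1.trans (add_le_add le_rfl (mul_le_mul_of_nonneg_right (by simp) hε.le))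

/-- An approximate best response of the min-player. -/
lemma exists_policy_le_dpV (hR0 : 0 ≤ R) (hR : ∀ h z, M.reward h z ≤ R) {ε : ℝ} (hε : 0 < ε)
    (μ : Policy H S A) :
    ∃ ν : Policy H S B, ∀ (h : ℕ) (s : S), M.V μ ν h s ≤ M.dpV h s + H * ε := by
  -- The response is selected with `μ` known. Signs are reversed because the selection lemma deals
  -- with strict lower bounds.
  have key : ∀ h : Fin H, ∃ κ : Kernel S B, IsMarkovKernel κ ∧ ∀ s,
      -guaranteed (fun a b => M.dpQ h (s, a, b)) (μ.probs h s) - ε <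
        -payoff (fun a b => M.dpQ h (s, a, b)) (μ.probs h s) (fun b => (κ s).real {b}) := by
    intro h
    refine exists_kernel_lt
      (fun s y => -payoff (fun a b => M.dpQ h (s, a, b)) (μ.probs h s) y) _
      (fun y => ?_) ?_ (fun s => (continuous_payoff _ _).neg) (fun s => ?_)
    · refine (Finset.measurable_sum _ fun a _ => Finset.measurable_sum _ fun b _ => ?_).neg
      exact ((measurable_probs μ h a).mul (measurable_dpQ_slice h a b)).mul measurable_const
    · exact (measurable_guaranteed (measurable_dpQ_slice h) (measurable_probs μ h)).neg.sub_const ε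
    · obtain ⟨y, hy⟩ := exists_lt_of_ciInf_lt (f := fun y : stdSimplex ℝ B =>
        payoff (fun a b => M.dpQ h (s, a, b)) (μ.probs h s) (y : B → ℝ))
        (show _ < guaranteed (fun a b => M.dpQ h (s, a, b)) (μ.probs h s) + ε from
          lt_add_of_pos_right _ hε)
      exact ⟨y, y.2, by linarith⟩
  choose κ hκ hlt using key
  refine ⟨⟨κ, hκ⟩, fun h s => ?_⟩
  set ν : Policy H S B := ⟨κ, hκ⟩
  obtain hh | hh := le_total H h
  · rw [dpV_of_le M hh, V_eq_valueOf, valueOf_of_le M μ ν _ hh]; positivity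
  -- Dually, lowering every reward by `ε` makes `dpV` a supersolution.
  have h1 : M.valueOf (fun h z => M.reward h z + -ε) μ ν h s ≤ M.dpV h s := by
    refine valueOf_le (c := R + ε) (fun h => (M.reward_measurable h).add_const (-ε))
      (fun h z => (abs_add_le _ _).trans (add_le_add (abs_reward_le hR h z)
        (by rw [abs_neg, abs_of_pos hε])))
      M.measurable_dpV (abs_dpV_le' hR0 hR) (fun s => (dpV_of_le M le_rfl s).ge) ?_ hh s
    intro h hh s
    have h2 : ∀ z, M.reward ⟨h, hh⟩ z + -ε + ∫ s', M.dpV (h + 1) s' ∂(M.trans ⟨h, hh⟩ z) =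
        M.dpQ ⟨h, hh⟩ z + -ε := fun z => by rw [dpQ]; ring
    simp_rw [h2]
    rw [integral_stepKer _ _ _ _ ((M.measurable_dpQ _).add_const (-ε)), dpV_of_lt M hh]
    have h3 := hlt ⟨h, hh⟩ s
    have h4 := payoff_le_payoff_add (M := fun a b => M.dpQ ⟨h, hh⟩ (s, a, b) + -ε)
      (M' := fun a b => M.dpQ ⟨h, hh⟩ (s, a, b)) (ε := -ε) (fun a b => le_rfl)
      (probs_mem_stdSimplex μ ⟨h, hh⟩ s) (probs_mem_stdSimplex ν ⟨h, hh⟩ s)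
    have h5 := guaranteed_le_matrixValue (fun a b => M.dpQ ⟨h, hh⟩ (s, a, b))
      (probs_mem_stdSimplex μ ⟨h, hh⟩ s)
    have h6 : payoff (fun a b => M.dpQ ⟨h, hh⟩ (s, a, b)) (μ.probs ⟨h, hh⟩ s)
        (ν.probs ⟨h, hh⟩ s) =
      payoff (fun a b => M.dpQ ⟨h, hh⟩ (s, a, b)) (μ.probs ⟨h, hh⟩ s)
        fun b => (κ ⟨h, hh⟩ s).real {b} := rfl
    linarith
  rw [valueOf_reward_add hR] at h1
  have h2 : ((H - h : ℕ) : ℝ) * ε ≤ H * ε := mul_le_mul_of_nonneg_right (by simp) hε.le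
  linarith

instance nonempty_policy {D : Type*} [MeasurableSpace D] [Nonempty D] :
    Nonempty (Policy H S D) :=
  ⟨⟨fun _ => Kernel.const S (Measure.dirac (Classical.arbitrary D)), fun _ => inferInstance⟩⟩

/-- A sup-inf equals `v` when `v` can be secured and enforced up to any positive error. -/
lemma iSup_iInf_eq {P Q : Type*} [Nonempty P] [Nonempty Q] {J : P → Q → ℝ} {b c v : ℝ}
    (hb : ∀ p q, b ≤ J p q) (hc : ∀ p q, J p q ≤ c)
    (h1 : ∀ ε > 0, ∃ p, ∀ q, v ≤ J p q + ε) (h2 : ∀ ε > 0, ∀ p, ∃ q, J p q ≤ v + ε) :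
    ⨆ p, ⨅ q, J p q = v := by
  have hbdd : ∀ p, BddBelow (Set.range (J p)) := fun p => ⟨b, by rintro _ ⟨q, rfl⟩; exact hb p q⟩
  refine le_antisymm (ciSup_le fun p => ?_) ?_
  · refine le_of_forall_pos_le_add fun ε hε => ?_
    obtain ⟨q, hq⟩ := h2 ε hε p
    exact (ciInf_le (hbdd p) q).trans hq
  · refine le_of_forall_pos_le_add fun ε hε => ?_
    obtain ⟨p, hp⟩ := h1 ε hε
    rw [← sub_le_iff_le_add]
    refine le_ciSup_of_le ⟨c, ?_⟩ p (le_ciInf fun q => by linarith [hp q])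
    rintro _ ⟨p, rfl⟩
    exact (ciInf_le (hbdd p) (Classical.arbitrary Q)).trans (hc _ _)

/-- The max-player can secure `dpV` up to any error, and any of its policies can be held to `dpV` up
to any error. Accuracy `ε / (H + 1)` per step keeps the total below `ε`. -/
theorem Vstar_eq_dpV (hR0 : 0 ≤ R) (hR : ∀ h z, M.reward h z ≤ R) (h : ℕ) (s : S) :
    M.Vstar h s = M.dpV h s := by
  have hH : (0 : ℝ) < H + 1 := by positivity
  have hle : ∀ ε : ℝ, 0 < ε → H * (ε / (H + 1)) ≤ ε := fun ε hε => by
    rw [← mul_div_assoc, div_le_iff₀ hH]; nlinarith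
  refine iSup_iInf_eq (fun μ ν => V_nonneg μ ν h s)
    (fun μ ν => (le_abs_self _).trans (abs_V_le hR0 hR μ ν h s)) (fun ε hε => ?_)
    (fun ε hε μ => ?_)
  · obtain ⟨μ, hμ⟩ := exists_policy_dpV_le (M := M) hR0 hR (div_pos hε hH)
    exact ⟨μ, fun ν => by linarith [hμ ν h s, hle ε hε]⟩
  · obtain ⟨ν, hν⟩ := exists_policy_le_dpV (M := M) hR0 hR (div_pos hε hH) μ
    exact ⟨ν, by linarith [hν h s, hle ε hε]⟩

/-- The near-optimal policies work for all states at once, so the sup-inf can be passed through the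
expectation over the next state. -/
theorem Qstar_eq_dpQ (hR0 : 0 ≤ R) (hR : ∀ h z, M.reward h z ≤ R) (h : Fin H)
    (z : S × A × B) : M.Qstar h z = M.dpQ h z := by
  have hH : (0 : ℝ) < H + 1 := by positivity
  have hle : ∀ ε : ℝ, 0 < ε → H * (ε / (H + 1)) ≤ ε := fun ε hε => by
    rw [← mul_div_assoc, div_le_iff₀ hH]; nlinarith
  have hV : ∀ μ ν, Integrable (M.V μ ν (h + 1)) (M.trans h z) := fun μ ν =>
    integrable_of_abs_le (measurable_V μ ν _) (abs_V_le hR0 hR μ ν _)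
  have hW : Integrable (M.dpV (h + 1)) (M.trans h z) :=
    integrable_of_abs_le (M.measurable_dpV _) (abs_dpV_le' hR0 hR _)
  unfold Qstar
  simp_rw [Q_eq hR]
  refine iSup_iInf_eq (b := 0) (c := R + H * R) (fun μ ν => ?_) (fun μ ν => ?_)
    (fun ε hε => ?_) (fun ε hε μ => ?_)
  · exact add_nonneg (M.reward_nonneg h z) (integral_nonneg fun s => V_nonneg μ ν _ s)
  · exact add_le_add (hR h z) ((le_abs_self _).trans
      (abs_integral_le_of_abs_le (abs_V_le hR0 hR μ ν _)))
  · obtain ⟨μ, hμ⟩ := exists_policy_dpV_le (M := M) hR0 hR (div_pos hε hH)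
    refine ⟨μ, fun ν => ?_⟩
    have := integral_mono hW ((hV μ ν).add (integrable_const ε))
      fun s => by simpa using (hμ ν (h + 1) s).trans (add_le_add le_rfl (hle ε hε))
    simp only [Pi.add_apply] at this
    rw [integral_add (hV μ ν) (integrable_const ε)] at this
    simp only [integral_const, probReal_univ, one_smul] at this
    rw [dpQ]; linarith
  · obtain ⟨ν, hν⟩ := exists_policy_le_dpV (M := M) hR0 hR (div_pos hε hH) μ
    refine ⟨ν, ?_⟩
    have := integral_mono (hV μ ν) (hW.add (integrable_const ε))
      fun s => by simpa using (hν (h + 1) s).trans (add_le_add le_rfl (hle ε hε))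
    simp only [Pi.add_apply] at this
    rw [integral_add hW (integrable_const ε)] at this
    simp only [integral_const, probReal_univ, one_smul] at this
    rw [dpQ]; linarith

end Game

/-! ### From small residuals on the past to small residuals at the visited points. -/

section EluderBound

/-- Greedy colouring: if the weights that each index puts on its predecessors sum to less than
`N * a`, then `N` colours suffice for every index to put weight at most `a` on the predecessors of
its own colour. -/
lemma exists_coloring (w : ℕ → ℕ → ℝ) (N : ℕ) (a : ℝ) (I : Finset ℕ)
    (hI : ∀ t ∈ I, ∑ i ∈ I with i < t, w t i < N * a) :
    ∃ c : ℕ → ℕ, (∀ t ∈ I, c t < N) ∧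
      ∀ t ∈ I, ∑ i ∈ I with i < t ∧ c i = c t, w t i ≤ a := by
  induction I using Finset.induction_on_max with
  | empty => exact ⟨fun _ => 0, by simp, by simp⟩
  | insert m I hm ih =>
    have hmI : m ∉ I := fun h => lt_irrefl _ (hm m h)
    have hlt : ∀ t ∈ I, (insert m I).filter (· < t) = I.filter (· < t) := by
      intro t ht
      rw [Finset.filter_insert, if_neg (not_lt.2 (hm t ht).le)]
    obtain ⟨c, hcN, hc⟩ := ih fun t ht => by
      have := hI t (Finset.mem_insert_of_mem ht)
      rwa [hlt t ht] at this
    have hI' : ∑ i ∈ I, w m i < N * a := by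
      have := hI m (Finset.mem_insert_self m I)
      rwa [Finset.filter_insert, if_neg (lt_irrefl m), Finset.filter_true_of_mem hm] at this
    -- Pigeonhole: if `m` put weight above `a` on each of the `N` colours, its total weight would be
    -- at least `N * a`.
    obtain ⟨j, hj, hja⟩ : ∃ j ∈ Finset.range N, ∑ i ∈ I with c i = j, w m i ≤ a := by
      by_contra! hcon
      have h1 : ∑ j ∈ Finset.range N, ∑ i ∈ I with c i = j, w m i = ∑ i ∈ I, w m i :=
        Finset.sum_fiberwise_of_maps_to (fun i hi => Finset.mem_range.2 (hcN i hi)) _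
      have h2 := Finset.sum_le_sum fun j hj => (hcon j hj).le
      rw [h1] at h2
      simp only [Finset.sum_const, Finset.card_range, nsmul_eq_mul] at h2
      linarith
    have hne : ∀ t ∈ I, Function.update c m j t = c t := fun t ht =>
      Function.update_of_ne (fun h => hmI (by rwa [← h])) _ _
    refine ⟨Function.update c m j, fun t ht => ?_, fun t ht => ?_⟩
    · obtain rfl | ht := Finset.mem_insert.1 ht
      · simpa using Finset.mem_range.1 hj
      · rw [hne t ht]; exact hcN t ht
    · obtain rfl | ht := Finset.mem_insert.1 ht
      · refine le_trans (le_of_eq ?_) hja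
        refine Finset.sum_congr ?_ fun _ _ => rfl
        ext i
        simp only [Finset.mem_filter, Finset.mem_insert, Function.update_self]
        constructor
        · rintro ⟨rfl | hi, hit, hcj⟩
          · exact absurd hit (lt_irrefl _)
          · rw [hne i hi] at hcj; exact ⟨hi, hcj⟩
        · rintro ⟨hi, hcj⟩
          exact ⟨Or.inr hi, hm i hi, by rw [hne i hi, hcj]⟩
      · have htm := hm t ht
        refine le_trans (le_of_eq ?_) (hc t ht)
        refine Finset.sum_congr ?_ fun _ _ => rfl
        ext i
        simp only [Finset.mem_filter, Finset.mem_insert, hne t ht]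
        constructor
        · rintro ⟨rfl | hi, hit, hcj⟩
          · exact absurd hit (not_lt.2 htm.le)
          · rw [hne i hi] at hcj; exact ⟨hi, hit, hcj⟩
        · rintro ⟨hi, hit, hcj⟩
          exact ⟨Or.inr hi, hit, by rw [hne i hi, hcj]⟩

variable {X : Type*} [MeasurableSpace X] {𝒢 : Set (X → ℝ)} {ω : ℝ} {d : ℕ}

/-- An independent sequence of point masses, indexed by a finite set of times, is no longer than
the distributional Eluder dimension. -/
lemma card_le_of_independent (h𝒢 : ∀ g ∈ 𝒢, Measurable g)
    (hd : dimDE 𝒢 (Set.range Measure.dirac) ω ≤ d) {φ : ℕ → X → ℝ} {z : ℕ → X} {J : Finset ℕ}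
    (hφ : ∀ t ∈ J, φ t ∈ 𝒢) {ε : ℝ} (hε0 : 0 ≤ ε) (hε : ω ≤ ε)
    (hpred : ∀ t ∈ J, ∑ i ∈ J with i < t, φ t (z i) ^ 2 ≤ ε ^ 2)
    (hlarge : ∀ t ∈ J, ε < |φ t (z t)|) : J.card ≤ d := by
  have key : (J.card : ℕ∞) ≤ d := by
    refine le_trans (le_sSup ?_) hd
    let e := J.orderEmbOfFin rfl
    have he : ∀ i, e i ∈ J := fun i => J.orderEmbOfFin_mem rfl i
    refine ⟨J.card, rfl, fun i => Measure.dirac (z (e i)), fun i => ⟨_, rfl⟩, ε, hε, fun i => ?_⟩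
    have hm := (h𝒢 _ (hφ (e i) (he i))).stronglyMeasurable
    refine ⟨φ (e i), hφ _ (he i), ?_, ?_⟩
    · simp only [integral_dirac' _ _ hm]
      refine Real.sqrt_le_iff.2 ⟨hε0, le_trans ?_ (hpred _ (he i))⟩
      have hmap := Finset.sum_map (Finset.Iio i) e.toEmbedding fun j => φ (e i) (z j) ^ 2
      refine hmap.symm.le.trans ?_
      refine Finset.sum_le_sum_of_subset_of_nonneg (fun j hj => ?_) fun _ _ _ => sq_nonneg _
      obtain ⟨k, hk, rfl⟩ := Finset.mem_map.1 hj
      exact Finset.mem_filter.2 ⟨he k, e.strictMono (Finset.mem_Iio.1 hk)⟩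
    · rw [integral_dirac' _ _ hm]
      exact hlarge _ (he i)
  exact_mod_cast key

/-- The number of large residuals at the visited points. -/
lemma card_mul_sq_le (h𝒢 : ∀ g ∈ 𝒢, Measurable g)
    (hd : dimDE 𝒢 (Set.range Measure.dirac) ω ≤ d) {φ : ℕ → X → ℝ} {z : ℕ → X} {I : Finset ℕ}
    (hφ : ∀ t ∈ I, φ t ∈ 𝒢) {b : ℝ} (hb : 0 ≤ b) (hω : 0 ≤ ω)
    (hpred : ∀ t ∈ I, ∑ i ∈ I with i < t, φ t (z i) ^ 2 ≤ b)
    {e : ℝ} (he : ω < e) (hlarge : ∀ t ∈ I, e ≤ |φ t (z t)|) :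
    ((I.card : ℝ) - d) * e ^ 2 ≤ b * d := by
  have he0 : 0 < e := hω.trans_lt he
  -- The least number of colours with `b < N * e ^ 2`, as the greedy colouring requires.
  set N : ℕ := ⌊b / e ^ 2⌋₊ + 1 with hN
  have hN1 : b < N * e ^ 2 := by
    have := Nat.lt_floor_add_one (b / e ^ 2)
    rw [div_lt_iff₀ (by positivity)] at this
    exact_mod_cast this
  -- Independence needs values strictly above the threshold, while the residuals are only known to
  -- be at least `e`. A threshold `α` just below `e` works, since `ω < e` and `b < N * e ^ 2` are
  -- open conditions.
  obtain ⟨α, hωα, hαe, hbα⟩ : ∃ α, ω ≤ α ∧ α < e ∧ b < N * α ^ 2 := by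
    have hcont : Filter.Tendsto (fun α : ℝ => N * α ^ 2) (nhdsWithin e (Set.Iio e))
        (nhds (N * e ^ 2)) :=
      ((continuous_const.mul (continuous_pow 2)).tendsto e).mono_left nhdsWithin_le_nhds
    have h1 := hcont.eventually (lt_mem_nhds hN1)
    have h2 : ∀ᶠ α in nhdsWithin e (Set.Iio e), α ∈ Set.Ioo ω e := Ioo_mem_nhdsLT he
    obtain ⟨α, h1, h2⟩ := (h1.and h2).exists
    exact ⟨α, h2.1.le, h2.2, h1⟩
  obtain ⟨c, hcN, hc⟩ := exists_coloring (fun t i => φ t (z i) ^ 2) N (α ^ 2) I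
    fun t ht => (hpred t ht).trans_lt hbα
  -- Each colour class is an `α`-independent sequence, hence has at most `d` elements.
  have hcard : I.card ≤ d * N := by
    rw [Finset.card_eq_sum_card_fiberwise (t := Finset.range N) (f := c)
      (fun t ht => by simpa using hcN t ht)]
    refine (Finset.sum_le_card_nsmul _ _ d fun j hj => ?_).trans (by simp [mul_comm])
    refine card_le_of_independent h𝒢 hd (φ := φ) (z := z) (ε := α)
      (fun t ht => hφ t (Finset.mem_filter.1 ht).1) (hω.trans hωα) hωα (fun t ht => ?_)
      fun t ht => hαe.trans_le (hlarge t (Finset.mem_filter.1 ht).1)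
    obtain ⟨htI, htj⟩ := Finset.mem_filter.1 ht
    refine le_trans (le_of_eq (Finset.sum_congr ?_ fun _ _ => rfl)) (hc t htI)
    ext i
    simp only [Finset.mem_filter, htj]
    tauto
  have hcard' : (I.card : ℝ) ≤ d * N := by exact_mod_cast hcard
  have hfl : ((N : ℝ) - 1) * e ^ 2 ≤ b := by
    have := Nat.floor_le (div_nonneg hb (sq_nonneg e))
    rw [le_div_iff₀ (by positivity)] at this
    rw [hN]; push_cast; linarith
  calc ((I.card : ℝ) - d) * e ^ 2 ≤ (d * N - d) * e ^ 2 :=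
        mul_le_mul_of_nonneg_right (by linarith) (sq_nonneg e)
    _ = d * ((N - 1) * e ^ 2) := by ring
    _ ≤ d * b := mul_le_mul_of_nonneg_left hfl (Nat.cast_nonneg d)
    _ = b * d := mul_comm _ _

/-- If at most `d + b / a ^ 2` of the numbers `e i` are at least as large as any given one of
them, `a`, then their sum is of order `√(b n)`. -/
lemma sum_le_of_card_mul_sq_le {ι : Type*} [DecidableEq ι] (e : ι → ℝ) {b c : ℝ}
    (d : ℕ) (I : Finset ι) (he0 : ∀ i ∈ I, 0 ≤ e i) (hec : ∀ i ∈ I, e i ≤ c)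
    (hcard : ∀ t ∈ I, (((I.filter fun i => e t ≤ e i).card : ℝ) - d) * e t ^ 2 ≤ b) :
    ∑ i ∈ I, e i ≤ c * (min d I.card : ℕ) + 2 * √b * √((I.card - d : ℕ) : ℝ) := by
  induction I using Finset.induction_on_min_value e with
  | empty => simp
  | insert a I ha hmin ih =>
    have ih := ih (fun i hi => he0 i (Finset.mem_insert_of_mem hi))
      (fun i hi => hec i (Finset.mem_insert_of_mem hi)) fun t ht => by
        refine le_trans (mul_le_mul_of_nonneg_right (sub_le_sub_right ?_ _) (sq_nonneg _))
          (hcard t (Finset.mem_insert_of_mem ht))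
        exact_mod_cast Finset.card_le_card
          (Finset.filter_subset_filter _ (Finset.subset_insert _ _))
    rw [Finset.sum_insert ha, Finset.card_insert_of_notMem ha]
    have hea := hec a (Finset.mem_insert_self a I)
    have hea0 := he0 a (Finset.mem_insert_self a I)
    have hca := hcard a (Finset.mem_insert_self a I)
    rw [Finset.filter_true_of_mem (by
      intro i hi
      obtain rfl | hi := Finset.mem_insert.1 hi
      · exact le_rfl
      · exact hmin i hi), Finset.card_insert_of_notMem ha] at hca
    -- Elements enter in decreasing order. The first `d` are charged `c` each; the later ones are
    -- controlled by the counting hypothesis.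
    obtain hd | hd := le_or_gt (I.card + 1) d
    · rw [min_eq_right hd, Nat.sub_eq_zero_of_le hd]
      rw [min_eq_right (by omega), Nat.sub_eq_zero_of_le (by omega)] at ih
      push_cast at ih ⊢
      linarith
    · obtain ⟨m, hm⟩ : ∃ m, I.card = d + m := ⟨I.card - d, by omega⟩
      rw [hm] at ih hca ⊢
      rw [min_eq_left (by omega), show d + m + 1 - d = m + 1 by omega]
      rw [min_eq_left (by omega), show d + m - d = m by omega] at ih
      push_cast at hca ⊢
      -- All `d + m + 1` elements are at least the new minimum `e a`, so `e a ≤ √(b / (m + 1))`.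
      -- This is at most `2 √b (√(m + 1) - √m)`, and these increments telescope.
      have h1 : ((m : ℝ) + 1) * e a ^ 2 ≤ b := by linarith
      have h2 : √((m : ℝ) + 1) * e a ≤ √b := by
        refine Real.le_sqrt_of_sq_le ?_
        rw [mul_pow, Real.sq_sqrt (by positivity)]
        exact h1
      have hx := Real.sq_sqrt (show (0 : ℝ) ≤ m by positivity)
      have hy := Real.sq_sqrt (show (0 : ℝ) ≤ (m : ℝ) + 1 by positivity)
      have hxy : √(m : ℝ) ≤ √((m : ℝ) + 1) := Real.sqrt_le_sqrt (by linarith)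
      have hy0 : 0 < √((m : ℝ) + 1) := Real.sqrt_pos.2 (by positivity)
      have hb0 := Real.sqrt_nonneg b
      have h3 : 1 ≤ 2 * √((m : ℝ) + 1) * (√((m : ℝ) + 1) - √(m : ℝ)) := by
        nlinarith [Real.sqrt_nonneg (m : ℝ)]
      have h4 : e a ≤ 2 * √b * (√((m : ℝ) + 1) - √(m : ℝ)) := by
        have h5 : e a ≤ e a * (2 * √((m : ℝ) + 1) * (√((m : ℝ) + 1) - √(m : ℝ))) :=
          le_mul_of_one_le_right hea0 h3
        have h6 : (√((m : ℝ) + 1) * e a) * (2 * (√((m : ℝ) + 1) - √(m : ℝ))) ≤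
            √b * (2 * (√((m : ℝ) + 1) - √(m : ℝ))) :=
          mul_le_mul_of_nonneg_right h2 (by linarith)
        linarith
      linarith

/-- Residuals that are small on the past in mean square have a small sum along the sequence of
visited points, when the distributional Eluder dimension over point masses is small. -/
theorem sum_abs_le_of_dimDE (h𝒢 : ∀ g ∈ 𝒢, Measurable g)
    (hd : dimDE 𝒢 (Set.range Measure.dirac) ω ≤ d) {φ : ℕ → X → ℝ} {z : ℕ → X} {k : ℕ}
    (hφ : ∀ t < k, φ t ∈ 𝒢) {b c : ℝ} (hb : 0 ≤ b) (hω : 0 ≤ ω)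
    (hpred : ∀ t < k, ∑ i ∈ Finset.range t, φ t (z i) ^ 2 ≤ b)
    (hc0 : 0 ≤ c) (hc : ∀ t < k, |φ t (z t)| ≤ c) :
    ∑ t ∈ Finset.range k, |φ t (z t)| ≤ k * ω + c * (min d k : ℕ) + 2 * √(b * d * k) := by
  set I := (Finset.range k).filter fun t => ω < |φ t (z t)| with hI
  have hIk : ∀ t ∈ I, t < k := fun t ht => Finset.mem_range.1 (Finset.mem_filter.1 ht).1
  have hcardI : I.card ≤ k := (Finset.card_filter_le _ _).trans (by simp)
  -- Residuals not exceeding the resolution `ω` are charged `ω` each; only the larger ones are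
  -- counted through the dimension.
  have h1 : ∑ t ∈ Finset.range k, |φ t (z t)| ≤ k * ω + ∑ t ∈ I, |φ t (z t)| := by
    rw [← Finset.sum_filter_add_sum_filter_not (Finset.range k) fun t => ω < |φ t (z t)|, add_comm]
    refine add_le_add ?_ le_rfl
    refine (Finset.sum_le_card_nsmul _ _ ω fun t ht => not_lt.1 (Finset.mem_filter.1 ht).2).trans ?_
    rw [nsmul_eq_mul]
    refine mul_le_mul_of_nonneg_right ?_ hω
    exact_mod_cast (Finset.card_filter_le _ _).trans (by simp)
  have h2 := sum_le_of_card_mul_sq_le (fun t => |φ t (z t)|) (b := b * d) (c := c)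
    d I (fun _ _ => abs_nonneg _) (fun t ht => hc t (hIk t ht))
    fun t ht => by
      refine card_mul_sq_le h𝒢 hd (φ := φ) (z := z)
        (fun s hs => hφ s (hIk s (Finset.mem_filter.1 hs).1)) hb hω (fun s hs => ?_)
        (Finset.mem_filter.1 ht).2 (fun s hs => (Finset.mem_filter.1 hs).2)
      refine le_trans (Finset.sum_le_sum_of_subset_of_nonneg (fun i hi => ?_)
        fun _ _ _ => sq_nonneg _) (hpred s (hIk s (Finset.mem_filter.1 hs).1))
      exact Finset.mem_range.2 (Finset.mem_filter.1 hi).2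
  have h3 : c * (min d I.card : ℕ) ≤ c * (min d k : ℕ) :=
    mul_le_mul_of_nonneg_left (by exact_mod_cast min_le_min_left d hcardI) hc0
  have h4 : 2 * √(b * d) * √((I.card - d : ℕ) : ℝ) ≤ 2 * √(b * d * k) := by
    rw [mul_assoc, ← Real.sqrt_mul (mul_nonneg hb (Nat.cast_nonneg d))]
    refine mul_le_mul_of_nonneg_left (Real.sqrt_le_sqrt ?_) zero_le_two
    refine mul_le_mul_of_nonneg_left ?_ (mul_nonneg hb (Nat.cast_nonneg d))
    exact_mod_cast (Nat.sub_le _ _).trans hcardI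
  linarith

end EluderBound

/-! ### Integration against a conditional law. -/

section ConditionalLaw

variable {Ω T : Type*} {𝓕 : MeasurableSpace Ω} [mΩ : MeasurableSpace Ω] [MeasurableSpace T]
  {P : Measure Ω} [IsProbabilityMeasure P] {X : Ω → T} {law : Ω → Measure T}

/-- Restricting `P` to `E` and weighting `P` by the conditional probability of `E` give the same
measure on `𝓕`, hence the same integral of every nonnegative `𝓕`-measurable weight, bounded or not.
-/
lemma lintegral_mul_condExp_indicator (h𝓕 : 𝓕 ≤ mΩ) {E : Set Ω} (hE : MeasurableSet E)
    {W : Ω → ℝ≥0∞} (hW : Measurable[𝓕] W) :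
    ∫⁻ ω, W ω * E.indicator 1 ω ∂P = ∫⁻ ω, W ω * ENNReal.ofReal ((P⟦E | 𝓕⟧) ω) ∂P := by
  have hint : Integrable (E.indicator fun _ => (1 : ℝ)) P :=
    (integrable_const (1 : ℝ)).indicator hE
  have hce : Measurable fun ω => ENNReal.ofReal ((P⟦E | 𝓕⟧) ω) :=
    ((stronglyMeasurable_condExp.mono h𝓕).measurable).ennreal_ofReal
  have hpos : 0 ≤ᵐ[P] P⟦E | 𝓕⟧ :=
    condExp_nonneg (Filter.Eventually.of_forall fun ω => Set.indicator_nonneg (by simp) ω)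
  have hmeas : (P.restrict E).trim h𝓕 =
      (P.withDensity fun ω => ENNReal.ofReal ((P⟦E | 𝓕⟧) ω)).trim h𝓕 := by
    refine @Measure.ext _ 𝓕 _ _ fun s hs => ?_
    rw [trim_measurableSet_eq h𝓕 hs, trim_measurableSet_eq h𝓕 hs, Measure.restrict_apply (h𝓕 s hs),
      withDensity_apply _ (h𝓕 s hs), ← ofReal_integral_eq_lintegral_ofReal
        integrable_condExp.integrableOn (ae_restrict_of_ae hpos), setIntegral_condExp h𝓕 hint hs,
      setIntegral_indicator hE]
    simp
  have h1 : ∫⁻ ω, W ω * E.indicator 1 ω ∂P = ∫⁻ ω, W ω ∂(P.restrict E) := by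
    rw [← lintegral_indicator hE]
    refine lintegral_congr fun ω => ?_
    by_cases hω : ω ∈ E <;> simp [hω]
  rw [h1, ← lintegral_trim h𝓕 hW, hmeas, lintegral_trim h𝓕 hW,
    lintegral_withDensity_eq_lintegral_mul _ hce (hW.mono h𝓕 le_rfl)]
  refine lintegral_congr fun ω => ?_
  rw [Pi.mul_apply, mul_comm]

/-- Integrals of functions of `X` against `𝓕`-measurable weights can be computed under a
conditional law of `X` given `𝓕`. -/
lemma exists_lintegral_law (h𝓕 : 𝓕 ≤ mΩ) (hX : Measurable X)
    [∀ ω, IsProbabilityMeasure (law ω)]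
    (hlaw : ∀ E, MeasurableSet E → P⟦X ⁻¹' E | 𝓕⟧ =ᵐ[P] fun ω => (law ω).real E)
    {Φ : T → ℝ≥0∞} (hΦ : Measurable Φ) :
    ∃ g : Ω → ℝ≥0∞, Measurable[𝓕] g ∧ (g =ᵐ[P] fun ω => ∫⁻ x, Φ x ∂(law ω)) ∧
      ∀ W : Ω → ℝ≥0∞, Measurable[𝓕] W →
        ∫⁻ ω, W ω * Φ (X ω) ∂P = ∫⁻ ω, W ω * g ω ∂P := by
  -- The integral under `law ω` agrees with conditional probabilities only almost surely and may
  -- fail to be `𝓕`-measurable, so a measurable version `g` is carried through the induction.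
  refine Measurable.ennreal_induction ?_ ?_ ?_ hΦ
  · intro c E hE
    refine ⟨fun ω => c * ENNReal.ofReal ((P⟦X ⁻¹' E | 𝓕⟧) ω),
      (stronglyMeasurable_condExp.measurable.ennreal_ofReal).const_mul c, ?_, fun W hW => ?_⟩
    · filter_upwards [hlaw E hE] with ω hω
      rw [hω, lintegral_indicator_const hE, ofReal_measureReal]
    · have h := lintegral_mul_condExp_indicator (P := P) h𝓕 (hX hE)
        (W := fun ω => W ω * c) (hW.mul_const c)
      simp only [← mul_assoc]
      rw [← h]
      refine lintegral_congr fun ω => ?_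
      by_cases hω : X ω ∈ E <;> simp [hω]
  · intro f₁ f₂ _ hf₁ hf₂ ih₁ ih₂
    obtain ⟨g₁, hg₁, he₁, hi₁⟩ := ih₁
    obtain ⟨g₂, hg₂, he₂, hi₂⟩ := ih₂
    refine ⟨fun ω => g₁ ω + g₂ ω, hg₁.add hg₂, ?_, fun W hW => ?_⟩
    · filter_upwards [he₁, he₂] with ω h₁ h₂
      simp only [Pi.add_apply]
      rw [h₁, h₂, lintegral_add_left hf₁]
    · simp only [Pi.add_apply, mul_add]
      have hW' := hW.mono h𝓕 le_rfl
      have hm₁ : Measurable fun ω => W ω * f₁ (X ω) := hW'.mul (hf₁.comp hX)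
      have hm₂ : Measurable fun ω => W ω * g₁ ω := hW'.mul (hg₁.mono h𝓕 le_rfl)
      rw [lintegral_add_left hm₁, hi₁ W hW, hi₂ W hW, lintegral_add_left hm₂]
  · intro F hF hmono ih
    choose g hg he hi using ih
    refine ⟨fun ω => ⨆ n, g n ω, Measurable.iSup hg, ?_, fun W hW => ?_⟩
    · filter_upwards [ae_all_iff.2 he] with ω hω
      simp only [hω]
      rw [lintegral_iSup hF hmono]
    · have hW' := hW.mono h𝓕 le_rfl
      simp only [ENNReal.mul_iSup]
      have hm₁ : ∀ n, Measurable fun ω => W ω * F n (X ω) := fun n => hW'.mul ((hF n).comp hX)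
      have hm₂ : ∀ n, AEMeasurable (fun ω => W ω * g n ω) P := fun n =>
        (hW'.mul ((hg n).mono h𝓕 le_rfl)).aemeasurable
      rw [lintegral_iSup hm₁
        (fun m n hmn ω => mul_le_mul_right (hmono hmn (X ω)) (W ω)),
        lintegral_iSup' hm₂]
      · exact iSup_congr fun n => hi n W hW
      · filter_upwards [ae_all_iff.2 he] with ω hω m n hmn
        simp only [hω]
        exact mul_le_mul_right (lintegral_mono (hmono hmn)) (W ω)

/-- The same when the function of `X` is itself selected, among finitely many ones, by an
`𝓕`-measurable choice. -/
lemma exists_lintegral_law_select (h𝓕 : 𝓕 ≤ mΩ) (hX : Measurable X)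
    [∀ ω, IsProbabilityMeasure (law ω)]
    (hlaw : ∀ E, MeasurableSet E → P⟦X ⁻¹' E | 𝓕⟧ =ᵐ[P] fun ω => (law ω).real E)
    {Q : Type*} (𝒬 : Finset Q) {q : Ω → Q} (hq : ∀ ω, q ω ∈ 𝒬)
    (hqm : ∀ p, MeasurableSet[𝓕] {ω | q ω = p})
    {Φ : Q → T → ℝ≥0∞} (hΦ : ∀ p ∈ 𝒬, Measurable (Φ p)) :
    ∃ g : Ω → ℝ≥0∞, Measurable[𝓕] g ∧ (g =ᵐ[P] fun ω => ∫⁻ x, Φ (q ω) x ∂(law ω)) ∧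
      ∀ W : Ω → ℝ≥0∞, Measurable[𝓕] W →
        ∫⁻ ω, W ω * Φ (q ω) (X ω) ∂P = ∫⁻ ω, W ω * g ω ∂P := by
  classical
  have key : ∀ p : Q, ∃ g : Ω → ℝ≥0∞, p ∈ 𝒬 → Measurable[𝓕] g ∧
      (g =ᵐ[P] fun ω => ∫⁻ x, Φ p x ∂(law ω)) ∧
      ∀ W : Ω → ℝ≥0∞, Measurable[𝓕] W →
        ∫⁻ ω, W ω * Φ p (X ω) ∂P = ∫⁻ ω, W ω * g ω ∂P := by
    intro p
    by_cases hp : p ∈ 𝒬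
    · obtain ⟨g, hg⟩ := exists_lintegral_law h𝓕 hX hlaw (hΦ p hp)
      exact ⟨g, fun _ => hg⟩
    · exact ⟨0, fun h => absurd h hp⟩
  choose g hg using key
  have hsum : ∀ (F : Q → ℝ≥0∞) (ω : Ω),
      ∑ p ∈ 𝒬, {ω | q ω = p}.indicator (fun _ => F p) ω = F (q ω) := by
    intro F ω
    rw [Finset.sum_eq_single_of_mem (q ω) (hq ω)]
    · simp
    · intro p _ hp
      simp [hp.symm]
  refine ⟨fun ω => ∑ p ∈ 𝒬, {ω | q ω = p}.indicator (g p) ω, ?_, ?_, fun W hW => ?_⟩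
  · exact Finset.measurable_sum _ fun p hp => (hg p hp).1.indicator (hqm p)
  · have : ∀ᵐ ω ∂P, ∀ p : 𝒬, g p ω = ∫⁻ x, Φ p x ∂(law ω) :=
      ae_all_iff.2 fun p => (hg p p.2).2.1
    filter_upwards [this] with ω hω
    rw [← hω ⟨q ω, hq ω⟩]
    exact hsum (fun p => g p ω) ω
  · have hW1 : ∀ p, Measurable[𝓕] ({ω | q ω = p}.indicator W) := fun p => hW.indicator (hqm p)
    have h1 : ∀ (F : Q → Ω → ℝ≥0∞) (ω : Ω), W ω * F (q ω) ω =
        ∑ p ∈ 𝒬, {ω | q ω = p}.indicator W ω * F p ω := by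
      intro F ω
      rw [← hsum (fun p => F p ω) ω, Finset.mul_sum]
      refine Finset.sum_congr rfl fun p _ => ?_
      by_cases h : q ω = p <;> simp [h]
    have h2 : ∀ ω, W ω * ∑ p ∈ 𝒬, {ω | q ω = p}.indicator (g p) ω = W ω * g (q ω) ω :=
      fun ω => by rw [← hsum (fun p => g p ω) ω]; rfl
    simp only [h2, h1 g, h1 fun p ω => Φ p (X ω)]
    have hm1 : ∀ p ∈ 𝒬, Measurable fun ω => {ω | q ω = p}.indicator W ω * Φ p (X ω) :=
      fun p hp => ((hW1 p).mono h𝓕 le_rfl).mul ((hΦ p hp).comp hX)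
    have hm2 : ∀ p ∈ 𝒬, Measurable fun ω => {ω | q ω = p}.indicator W ω * g p ω :=
      fun p hp => ((hW1 p).mono h𝓕 le_rfl).mul ((hg p hp).1.mono h𝓕 le_rfl)
    rw [lintegral_finsetSum _ hm1, lintegral_finsetSum _ hm2]
    exact Finset.sum_congr rfl fun p hp => (hg p hp).2.2 _ (hW1 p)

end ConditionalLaw

/-! ### Exponential moments and Chernoff bounds. -/

section Hoeffding

/-- Hoeffding's lemma, with the compensator moved into the exponent so that products of such factors
along the episodes have mean at most one. -/
lemma lintegral_exp_centered_le {T : Type*} [MeasurableSpace T] {m : Measure T}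
    [IsProbabilityMeasure m] {R : T → ℝ} (hR : Measurable R) {a b : ℝ}
    (hab : ∀ x, R x ∈ Set.Icc a b) (l : ℝ) :
    ∫⁻ x, ENNReal.ofReal (Real.exp (l * (R x - ∫ y, R y ∂m) - l ^ 2 * (b - a) ^ 2 / 8)) ∂m ≤ 1 := by
  have hsub := hasSubgaussianMGF_of_mem_Icc (μ := m) hR.aemeasurable
    (Filter.Eventually.of_forall hab)
  have hint := hsub.integrable_exp_mul l
  have hmgf := hsub.mgf_le l
  have hc : (((‖b - a‖₊ / 2) ^ 2 : NNReal) : ℝ) * l ^ 2 / 2 = l ^ 2 * (b - a) ^ 2 / 8 := by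
    push_cast
    rw [Real.norm_eq_abs, div_pow, sq_abs]
    ring
  rw [hc, mgf] at hmgf
  have h1 : ∀ x, Real.exp (l * (R x - ∫ y, R y ∂m) - l ^ 2 * (b - a) ^ 2 / 8) =
      Real.exp (l * (R x - ∫ y, R y ∂m)) * Real.exp (-(l ^ 2 * (b - a) ^ 2 / 8)) := fun x => by
    rw [← Real.exp_add, sub_eq_add_neg]
  simp_rw [h1]
  rw [← ofReal_integral_eq_lintegral_ofReal (hint.mul_const _)
    (Filter.Eventually.of_forall fun x => by positivity), integral_mul_const]
  refine ENNReal.ofReal_le_one.2 ?_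
  calc _ ≤ Real.exp (l ^ 2 * (b - a) ^ 2 / 8) * Real.exp (-(l ^ 2 * (b - a) ^ 2 / 8)) :=
        mul_le_mul_of_nonneg_right hmgf (Real.exp_nonneg _)
    _ = 1 := by rw [← Real.exp_add, add_neg_cancel, Real.exp_zero]

end Hoeffding

section Supermartingale

variable {Ω : Type*} [mΩ : MeasurableSpace Ω] {P : Measure Ω} [IsProbabilityMeasure P]
  {𝓖 : Filtration ℕ mΩ} {K : ℕ} {y : ℕ → Ω → ℝ}

/-- Chernoff bound for the sum of adapted increments whose conditional exponential moments are at
most `1`. -/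
lemma measure_le_sum_le_exp (hy : ∀ t < K, Measurable[𝓖 (t + 1)] (y t))
    (hstep : ∀ t < K, ∀ W : Ω → ℝ≥0∞, Measurable[𝓖 t] W →
      ∫⁻ ω, W ω * ENNReal.ofReal (Real.exp (y t ω)) ∂P ≤ ∫⁻ ω, W ω ∂P)
    (L : ℝ) {k : ℕ} (hk : k ≤ K) :
    P {ω | L ≤ ∑ t ∈ Finset.range k, y t ω} ≤ ENNReal.ofReal (Real.exp (-L)) := by
  have hmeas : ∀ k ≤ K, Measurable[𝓖 k] fun ω =>
      ENNReal.ofReal (Real.exp (∑ t ∈ Finset.range k, y t ω)) := by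
    intro k hk
    refine (Real.measurable_exp.comp (Finset.measurable_sum _ fun t ht => ?_)).ennreal_ofReal
    have ht := Finset.mem_range.1 ht
    exact (hy t (ht.trans_le hk)).mono (𝓖.mono (by omega)) le_rfl
  have hint : ∀ k ≤ K, ∫⁻ ω, ENNReal.ofReal (Real.exp (∑ t ∈ Finset.range k, y t ω)) ∂P ≤ 1 := by
    intro k hk
    induction k with
    | zero => simp
    | succ k ih =>
      -- The exponential of the earlier increments is the past-measurable weight; the newest factor
      -- is removed by `hstep`.
      refine le_trans (le_trans (le_of_eq ?_) (hstep k (by omega) _ (hmeas k (by omega))))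
        (ih (by omega))
      refine lintegral_congr fun ω => ?_
      rw [Finset.sum_range_succ, Real.exp_add, ENNReal.ofReal_mul (Real.exp_nonneg _)]
  have hmk : Measurable fun ω => ENNReal.ofReal (Real.exp (∑ t ∈ Finset.range k, y t ω)) :=
    (hmeas k hk).mono (𝓖.le k) le_rfl
  have hpos : 0 < ENNReal.ofReal (Real.exp L) := ENNReal.ofReal_pos.2 (Real.exp_pos L)
  have hM := meas_ge_le_lintegral_div (μ := P) hmk.aemeasurable hpos.ne' ENNReal.ofReal_ne_top
  refine le_trans (measure_mono fun ω hω => ?_) (hM.trans ?_)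
  · exact ENNReal.ofReal_le_ofReal (Real.exp_le_exp.2 hω)
  · rw [Real.exp_neg, ENNReal.ofReal_inv_of_pos (Real.exp_pos L), ← one_div]
    exact ENNReal.div_le_div_right (hint k hk) _

end Supermartingale

lemma measure_not_forall_le {Ω ι : Type*} [MeasurableSpace Ω] {P : Measure Ω} (I : Finset ι)
    (p : ι → Ω → Prop) {e : ℝ≥0∞} (h : ∀ i ∈ I, P {ω | ¬p i ω} ≤ e) :
    P {ω | ¬∀ i ∈ I, p i ω} ≤ I.card * e := by
  have : {ω | ¬∀ i ∈ I, p i ω} = ⋃ i ∈ I, {ω | ¬p i ω} := by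
    ext ω; simp
  rw [this]
  refine (measure_biUnion_finset_le I _).trans ((Finset.sum_le_card_nsmul _ _ e h).trans_eq ?_)
  rw [nsmul_eq_mul]

/-! ### The regression noise. -/

section InducedValue

variable {H : ℕ} {S A B : Type*} [Fintype A] [Fintype B]

lemma inducedV_of_le (f : Fin H → S × A × B → ℝ) {h : ℕ} (hh : H ≤ h) (s : S) :
    inducedV f h s = 0 := dif_neg (not_lt.2 hh)

section

variable [MeasurableSpace S] [MeasurableSpace A] [MeasurableSpace B] (M : Game H S A B)

/-- The deviation of the value of the next state from its mean. -/
def Game.valueNoise (f : Fin H → S × A × B → ℝ) (h : Fin H) (τ : Fin H → S × A × B) : ℝ :=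
  (if hh : (h : ℕ) + 1 < H then inducedV f (h + 1) (τ ⟨h + 1, hh⟩).1 else 0) -
    ∫ s', inducedV f (h + 1) s' ∂(M.trans h (τ h))

/-- Excess squared loss relative to the Bellman backup of `f`. -/
lemma Game.loss_eq (τ : ℕ → Fin H → S × A × B) (k : ℕ) (h : Fin H) (ξ : S × A × B → ℝ)
    (f : Fin H → S × A × B → ℝ) :
    M.loss τ k h ξ f = ∑ t ∈ Finset.range k, (ξ (τ t h) - M.bellman f h (τ t h)) ^ 2 -
      2 * ∑ t ∈ Finset.range k, (ξ (τ t h) - M.bellman f h (τ t h)) * M.valueNoise f h (τ t) +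
      ∑ t ∈ Finset.range k, M.valueNoise f h (τ t) ^ 2 := by
  rw [Game.loss, Finset.mul_sum, ← Finset.sum_sub_distrib, ← Finset.sum_add_distrib]
  refine Finset.sum_congr rfl fun t _ => ?_
  unfold Game.bellman Game.valueNoise
  ring

end

variable [Nonempty A] [Nonempty B]

lemma inducedV_mem_Icc {f : Fin H → S × A × B → ℝ} (hf : ∀ h z, 0 ≤ f h z ∧ f h z ≤ 1) (h : ℕ)
    (s : S) : inducedV f h s ∈ Set.Icc (0 : ℝ) 1 := by
  unfold inducedV
  split_ifs
  · exact ⟨matrixValue_nonneg fun a b => (hf _ _).1, matrixValue_le fun a b => (hf _ _).2⟩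
  · simp

lemma abs_inducedV_le {f : Fin H → S × A × B → ℝ} (hf : ∀ h z, 0 ≤ f h z ∧ f h z ≤ 1) (h : ℕ)
    (s : S) : |inducedV f h s| ≤ 1 := by
  obtain ⟨h0, h1⟩ := inducedV_mem_Icc hf h s
  rwa [abs_of_nonneg h0]

variable [MeasurableSpace S] [MeasurableSpace A] [MeasurableSpace B]

lemma measurable_inducedV {f : Fin H → S × A × B → ℝ} (hf : ∀ h, Measurable (f h)) (h : ℕ) :
    Measurable (inducedV f h) := by
  unfold inducedV
  split_ifs
  · exact measurable_matrixValue fun a b => (hf _).comp (measurable_id.prodMk measurable_const)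
  · exact measurable_const

namespace Game

variable (M : Game H S A B)

lemma measurable_bellman {f : Fin H → S × A × B → ℝ} (hf : ∀ h, Measurable (f h)) (h : Fin H) :
    Measurable (M.bellman f h) :=
  (M.reward_measurable h).add (measurable_integral_kernel _ (measurable_inducedV hf _))

lemma measurable_valueNoise {f : Fin H → S × A × B → ℝ} (hf : ∀ h, Measurable (f h)) (h : Fin H) :
    Measurable (M.valueNoise f h) := by
  unfold valueNoise
  refine Measurable.sub ?_ ?_
  · split_ifs with hh
    · exact (measurable_inducedV hf _).comp (measurable_fst.comp (measurable_pi_apply _))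
    · exact measurable_const
  · exact (measurable_integral_kernel (M.trans h) (measurable_inducedV hf _)).comp
      (measurable_pi_apply h)

/-- Given the step, the next value lies in `[0, 1]`, so Hoeffding's lemma with parameter `2 * w` has
compensator `(2 * w) ^ 2 / 8 = w ^ 2 / 2`. Normalising by `w ^ 2` itself gives rates in `β` without
a variance-dependent martingale inequality. -/
lemma lintegral_exp_valueNoise_le {f : Fin H → S × A × B → ℝ} (hf : ∀ h, Measurable (f h))
    (hf01 : ∀ h z, 0 ≤ f h z ∧ f h z ≤ 1) (h : Fin H) {w : S × A × B → ℝ} (hw : Measurable w)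
    (μ : Policy H S A) (ν : Policy H S B) :
    ∫⁻ τ, ENNReal.ofReal (Real.exp (2 * (w (τ h) * M.valueNoise f h τ) - w (τ h) ^ 2 / 2))
      ∂(M.episodeLaw μ ν) ≤ 1 := by
  by_cases hh : (h : ℕ) + 1 < H
  · have hV := measurable_inducedV hf (h + 1)
    have hPV := measurable_integral_kernel (M.trans h) hV
    let Ψ : (S × A × B) × S → ℝ≥0∞ := fun p => ENNReal.ofReal (Real.exp
      (2 * (w p.1 * (inducedV f (h + 1) p.2 - ∫ s', inducedV f (h + 1) s' ∂(M.trans h p.1))) -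
        w p.1 ^ 2 / 2))
    have hΨ : Measurable Ψ := by
      have h1 : Measurable fun p : (S × A × B) × S => w p.1 := hw.comp measurable_fst
      have h2 : Measurable fun p : (S × A × B) × S => inducedV f (h + 1) p.2 :=
        hV.comp measurable_snd
      have h3 : Measurable fun p : (S × A × B) × S =>
          ∫ s', inducedV f (h + 1) s' ∂(M.trans h p.1) := hPV.comp measurable_fst
      exact (Real.measurable_exp.comp
        (((h1.mul (h2.sub h3)).const_mul 2).sub ((h1.pow_const 2).div_const 2))).ennreal_ofReal
    have := lintegral_rollout_transition_le (st := Prod.fst) measurable_fst (stepKer μ ν) M.trans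
      (fun i s => map_fst_stepKer μ ν i s) h hh hΨ (fun z => ?_) M.init
    · refine le_trans (le_of_eq (lintegral_congr fun τ => ?_)) this
      simp only [Ψ, valueNoise, dif_pos hh, Fin.eta]
    · refine le_trans (le_of_eq (lintegral_congr fun s' => ?_))
        (lintegral_exp_centered_le hV (inducedV_mem_Icc hf01 _) (2 * w z))
      simp only [Ψ, Fin.eta]
      congr 2
      ring
  -- After the last step there is no next value and the noise vanishes.
  · have h0 : ∀ τ, M.valueNoise f h τ = 0 := fun τ => by
      simp [valueNoise, dif_neg hh, inducedV_of_le f (not_lt.1 hh)]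
    refine (lintegral_mono (g := fun _ => (1 : ℝ≥0∞)) fun τ => ?_).trans_eq (by simp)
    refine ENNReal.ofReal_le_one.2 (Real.exp_le_one_iff.2 ?_)
    rw [h0]
    nlinarith [sq_nonneg (w (τ h))]

end Game

end InducedValue

/-! ### Chernoff bounds along a run. -/

namespace IsOnlineRun

variable {H : ℕ} {S A B : Type*} [Fintype A] [Fintype B]
  [MeasurableSpace S] [MeasurableSpace A] [MeasurableSpace B] {M : Game H S A B}
  {Ω : Type*} [mΩ : MeasurableSpace Ω] {P : Measure Ω} [IsProbabilityMeasure P]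
  {F G : Fin H → Finset (S × A × B → ℝ)} {β : ℝ} {K : ℕ} {𝓖 : Filtration ℕ mΩ}
  {f : ℕ → Ω → Fin H → S × A × B → ℝ} {μ : ℕ → Ω → Policy H S A} {ν : ℕ → Ω → Policy H S B}
  {τ : ℕ → Ω → Fin H → S × A × B}

/-- Chernoff bound for a fixed function of the episodes. -/
lemma measure_le_sum_le_exp (hrun : IsOnlineRun M P F G β K 𝓖 f μ ν τ)
    {u : (Fin H → S × A × B) → ℝ} (hu : Measurable u)
    (hexp : ∀ (μ : Policy H S A) (ν : Policy H S B),
      ∫⁻ τ, ENNReal.ofReal (Real.exp (u τ)) ∂(M.episodeLaw μ ν) ≤ 1)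
    (L : ℝ) {k : ℕ} (hk : k ≤ K) :
    P {ω | L ≤ ∑ t ∈ Finset.range k, u (τ t ω)} ≤ ENNReal.ofReal (Real.exp (-L)) := by
  refine MarkovGames.measure_le_sum_le_exp (𝓖 := 𝓖) (K := K) (y := fun t ω => u (τ t ω))
    (fun t ht => hu.comp (hrun.τ_measurable t ht)) (fun t ht W hW => ?_) L hk
  obtain ⟨g, -, hg, hi⟩ := exists_lintegral_law (P := P) (𝓖.le t)
    ((hrun.τ_measurable t ht).mono (𝓖.le _) le_rfl)
    (law := fun ω => M.episodeLaw (μ t ω) (ν t ω)) (hrun.τ_law t ht)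
    (Φ := fun τ => ENNReal.ofReal (Real.exp (u τ)))
    (Real.measurable_exp.comp hu).ennreal_ofReal
  rw [hi W hW]
  refine lintegral_mono_ae ?_
  filter_upwards [hg] with ω hω
  rw [hω]
  exact mul_le_of_le_one_right' (hexp _ _)

/-- Chernoff bound for the deviation of the observed values of `R (f t)` from their conditional
means. -/
lemma measure_le_sum_deviation_le_exp (hrun : IsOnlineRun M P F G β K 𝓖 f μ ν τ)
    {R : (Fin H → S × A × B → ℝ) → (Fin H → S × A × B) → ℝ}
    (hR : ∀ q, InClass F q → Measurable (R q)) {a b : ℝ}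
    (hab : ∀ q, InClass F q → ∀ τ, R q τ ∈ Set.Icc a b) (l L : ℝ) {k : ℕ} (hk : k ≤ K) :
    P {ω | L ≤ ∑ t ∈ Finset.range k,
      (l * ((∫ x, R (f t ω) x ∂(M.episodeLaw (μ t ω) (ν t ω))) - R (f t ω) (τ t ω)) -
        l ^ 2 * (b - a) ^ 2 / 8)} ≤ ENNReal.ofReal (Real.exp (-L)) := by
  classical
  have hmem : ∀ q, q ∈ Fintype.piFinset F ↔ InClass F q := fun q => Fintype.mem_piFinset
  have hsel := fun (t : ℕ) (ht : t < K) (Φ : (Fin H → S × A × B → ℝ) →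
      (Fin H → S × A × B) → ℝ≥0∞) (hΦ : ∀ q ∈ Fintype.piFinset F, Measurable (Φ q)) =>
    exists_lintegral_law_select (P := P) (𝓖.le t)
      ((hrun.τ_measurable t ht).mono (𝓖.le _) le_rfl)
      (law := fun ω => M.episodeLaw (μ t ω) (ν t ω)) (hrun.τ_law t ht)
      (Fintype.piFinset F) (q := f t) (fun ω => (hmem _).2 (hrun.f_mem t ht ω))
      (hrun.f_measurable t ht) hΦ
  -- A version of the conditional mean that is measurable at time `t`. Subtracting the lower bound
  -- `a` makes the integrand nonnegative, so that the Lebesgue-integral lemma applies.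
  have hD : ∀ t, ∃ D : Ω → ℝ, t < K → Measurable[𝓖 t] D ∧
      ∀ᵐ ω ∂P, D ω = ∫ x, R (f t ω) x ∂(M.episodeLaw (μ t ω) (ν t ω)) := by
    intro t
    by_cases ht : t < K
    · obtain ⟨g, hgm, hg, -⟩ := hsel t ht (fun q x => ENNReal.ofReal (R q x - a))
        fun q hq => ((hR q ((hmem q).1 hq)).sub_const a).ennreal_ofReal
      refine ⟨fun ω => (g ω).toReal + a, fun _ => ⟨hgm.ennreal_toReal.add_const a, ?_⟩⟩
      filter_upwards [hg] with ω hω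
      have hq := hrun.f_mem t ht ω
      have hint : Integrable (R (f t ω)) (M.episodeLaw (μ t ω) (ν t ω)) :=
        Integrable.of_mem_Icc a b (hR _ hq).aemeasurable
          (Filter.Eventually.of_forall (hab _ hq))
      rw [hω, ← integral_eq_lintegral_of_nonneg_ae
        (Filter.Eventually.of_forall fun x => sub_nonneg.2 (hab _ hq x).1)
        ((hR _ hq).sub_const a).aestronglyMeasurable, integral_sub hint (integrable_const _)]
      simp
    · exact ⟨0, fun h => absurd h ht⟩
  choose D hD using hD
  have hRτ : ∀ t < K, Measurable[𝓖 (t + 1)] fun ω => R (f t ω) (τ t ω) := by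
    intro t ht
    have heq : (fun ω => R (f t ω) (τ t ω)) = fun ω => ∑ q ∈ Fintype.piFinset F,
        {ω | f t ω = q}.indicator (fun ω => R q (τ t ω)) ω := by
      funext ω
      rw [Finset.sum_eq_single_of_mem (f t ω) ((hmem _).2 (hrun.f_mem t ht ω))]
      · simp
      · intro q _ hq
        simp [hq.symm]
    rw [heq]
    exact Finset.measurable_sum _ fun q hq =>
      ((hR q ((hmem q).1 hq)).comp (hrun.τ_measurable t ht)).indicator
        (𝓖.mono (Nat.le_succ t) _ (hrun.f_measurable t ht q))
  have hmain := MarkovGames.measure_le_sum_le_exp (P := P) (𝓖 := 𝓖) (K := K)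
    (y := fun t ω => l * (D t ω - R (f t ω) (τ t ω)) - l ^ 2 * (b - a) ^ 2 / 8)
    (fun t ht => (((((hD t ht).1).mono (𝓖.mono (Nat.le_succ t)) le_rfl).sub
      (hRτ t ht)).const_mul l).sub_const _) (fun t ht W hW => ?_) L hk
  · refine le_trans (measure_mono_ae ?_) hmain
    have : ∀ᵐ ω ∂P, ∀ t : Fin K,
        D t ω = ∫ x, R (f t ω) x ∂(M.episodeLaw (μ t ω) (ν t ω)) :=
      ae_all_iff.2 fun t => (hD t t.2).2
    filter_upwards [this] with ω hω hL
    refine le_trans (show L ≤ _ from hL) (le_of_eq (Finset.sum_congr rfl fun t ht => ?_))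
    rw [hω ⟨t, (Finset.mem_range.1 ht).trans_le hk⟩]
  · obtain ⟨g, -, hg, hi⟩ := hsel t ht (fun q x => ENNReal.ofReal (Real.exp (-l * R q x)))
      fun q hq => (Real.measurable_exp.comp
        ((hR q ((hmem q).1 hq)).const_mul (-l))).ennreal_ofReal
    -- The factor with the conditional mean is known before the episode and joins the weight,
    -- leaving an exponential of the observed value alone.
    have hW' : Measurable[𝓖 t] fun ω => W ω *
        ENNReal.ofReal (Real.exp (l * D t ω - l ^ 2 * (b - a) ^ 2 / 8)) :=
      hW.mul (Real.measurable_exp.comp (((hD t ht).1.const_mul l).sub_const _)).ennreal_ofReal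
    have hsplit : ∀ ω, W ω * ENNReal.ofReal (Real.exp
          (l * (D t ω - R (f t ω) (τ t ω)) - l ^ 2 * (b - a) ^ 2 / 8)) =
        W ω * ENNReal.ofReal (Real.exp (l * D t ω - l ^ 2 * (b - a) ^ 2 / 8)) *
          ENNReal.ofReal (Real.exp (-l * R (f t ω) (τ t ω))) := by
      intro ω
      rw [mul_assoc, ← ENNReal.ofReal_mul (Real.exp_nonneg _), ← Real.exp_add]
      congr 3
      ring
    simp_rw [hsplit]
    rw [hi _ hW']
    refine lintegral_mono_ae ?_
    filter_upwards [hg, (hD t ht).2] with ω hω hDω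
    rw [mul_assoc]
    refine mul_le_of_le_one_right' ?_
    have hq := hrun.f_mem t ht ω
    rw [hω, ← lintegral_const_mul' _ _ ENNReal.ofReal_ne_top]
    refine le_trans (le_of_eq (lintegral_congr fun x => ?_))
      (lintegral_exp_centered_le (hR _ hq) (hab _ hq) (-l))
    rw [← ENNReal.ofReal_mul (Real.exp_nonneg _), ← Real.exp_add, hDω]
    congr 2
    ring

end IsOnlineRun

/-! ### Bellman residuals and the confidence set. -/

namespace Game

section

variable {H : ℕ} {S A B : Type*} [MeasurableSpace S] [MeasurableSpace A] [MeasurableSpace B]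
  [Fintype A] [Fintype B]

/-- Bellman residual of `f` at step `h`. -/
def residual (M : Game H S A B) (f : Fin H → S × A × B → ℝ) (h : Fin H) (z : S × A × B) : ℝ :=
  f h z - M.bellman f h z

variable {M : Game H S A B} {F G : Fin H → Finset (S × A × B → ℝ)} {ε : ℝ}

lemma bellman_le (hG : IsValueClass G) (hcomp : M.Complete F G ε) {f : Fin H → S × A × B → ℝ}
    (hf : InClass F f) (h : Fin H) (z : S × A × B) : M.bellman f h z ≤ 1 + ε := by
  obtain ⟨g, hg, hgε⟩ := hcomp f hf h
  linarith [(abs_le.1 (hgε z)).2, ((hG h g hg).2 z).2]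

variable {β L : ℝ} {τ : ℕ → Fin H → S × A × B} {k : ℕ} {f : Fin H → S × A × B → ℝ}

/-- The regression noise at step `h` is dominated by the spread of `g` around the Bellman backup
of `f`, up to the level `L`. -/
def NoiseControlled (M : Game H S A B) (τ : ℕ → Fin H → S × A × B) (k : ℕ) (L : ℝ)
    (f : Fin H → S × A × B → ℝ) (h : Fin H) (g : S × A × B → ℝ) : Prop :=
  |2 * ∑ t ∈ Finset.range k, (g (τ t h) - M.bellman f h (τ t h)) * M.valueNoise f h (τ t)| ≤
    (∑ t ∈ Finset.range k, (g (τ t h) - M.bellman f h (τ t h)) ^ 2) / 2 + L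

lemma sum_sq_le_of_abs_le {X : Type*} {g g' : X → ℝ} (hg : ∀ z, |g z - g' z| ≤ ε) (k : ℕ)
    (z : ℕ → X) : ∑ t ∈ Finset.range k, (g (z t) - g' (z t)) ^ 2 ≤ k * ε ^ 2 := by
  refine (Finset.sum_le_card_nsmul _ _ (ε ^ 2) fun t _ => ?_).trans_eq (by simp)
  rw [← sq_abs]
  exact pow_le_pow_left₀ (abs_nonneg _) (hg _) 2

lemma bddBelow_loss (h : Fin H) :
    BddBelow (Set.range fun g : {g // g ∈ G h} => M.loss τ k h g.1 f) :=
  (Set.finite_range _).bddBelow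

/-- Under noise control, small residuals put `f` in the confidence set. -/
lemma mem_confSet (hG : ∀ h, (G h).Nonempty) (hf : InClass F f)
    (hres : ∀ h z, |M.residual f h z| ≤ ε)
    (hL : ∀ h, ∀ g, g = f h ∨ g ∈ G h → M.NoiseControlled τ k L f h g)
    (hβ : 3 / 2 * (k * ε ^ 2) + 2 * L ≤ β) : f ∈ M.confSet F G β τ k := by
  refine ⟨hf, fun _ h => ?_⟩
  have : Nonempty {g // g ∈ G h} := (hG h).to_subtype
  rw [← sub_le_iff_le_add]
  refine le_ciInf fun g => ?_
  have h1 := abs_le.1 (hL h (f h) (Or.inl rfl))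
  have h2 := abs_le.1 (hL h g (Or.inr g.2))
  have h3 := sum_sq_le_of_abs_le (hres h) k fun t => τ t h
  have h4 : 0 ≤ ∑ t ∈ Finset.range k, (g.1 (τ t h) - M.bellman f h (τ t h)) ^ 2 :=
    Finset.sum_nonneg fun _ _ => sq_nonneg _
  rw [loss_eq, loss_eq]
  linarith [h1.1, h2.2]

/-- Under noise control, members of the confidence set have small residuals on the data. -/
lemma sum_residual_sq_le (hcomp : M.Complete F G ε) (hf : f ∈ M.confSet F G β τ k)
    (hL : ∀ h, ∀ g, g = f h ∨ g ∈ G h → M.NoiseControlled τ k L f h g)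
    (hβ : 0 ≤ 2 * β + 3 * (k * ε ^ 2) + 4 * L) (h : Fin H) :
    ∑ t ∈ Finset.range k, M.residual f h (τ t h) ^ 2 ≤ 2 * β + 3 * (k * ε ^ 2) + 4 * L := by
  obtain rfl | hk := Nat.eq_zero_or_pos k
  · simpa using hβ
  obtain ⟨g, hg, hgε⟩ := hcomp f hf.1 h
  have h0 := hf.2 hk h
  have h0' := ciInf_le (bddBelow_loss (M := M) (G := G) (τ := τ) (k := k) (f := f) h) ⟨g, hg⟩
  have h1 := abs_le.1 (hL h (f h) (Or.inl rfl))
  have h2 := abs_le.1 (hL h g (Or.inr hg))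
  have h3 := sum_sq_le_of_abs_le (fun z => (abs_sub_comm _ _).trans_le (hgε z)) k fun t => τ t h
  dsimp only at h0'
  rw [loss_eq] at h0 h0'
  unfold residual
  linarith [h1.2, h2.1]

end

variable {H : ℕ} {S A B : Type*} [MeasurableSpace S] [MeasurableSpace A] [MeasurableSpace B]
  [Fintype A] [Fintype B] [Nonempty A] [Nonempty B] {M : Game H S A B}
  {F G : Fin H → Finset (S × A × B → ℝ)} {ε : ℝ}

lemma bellman_nonneg {f : Fin H → S × A × B → ℝ} (hf : ∀ h z, 0 ≤ f h z ∧ f h z ≤ 1) (h : Fin H)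
    (z : S × A × B) : 0 ≤ M.bellman f h z :=
  add_nonneg (M.reward_nonneg h z) (integral_nonneg fun s => (inducedV_mem_Icc hf _ s).1)

/-- Completeness of a nonempty class bounds the rewards at every state. -/
lemma reward_le (hF : IsValueClass F) (hG : IsValueClass G) (hcomp : M.Complete F G ε)
    {f : Fin H → S × A × B → ℝ} (hf : InClass F f) (h : Fin H) (z : S × A × B) :
    M.reward h z ≤ 1 + ε := by
  have h1 := bellman_le hG hcomp hf h z
  have h2 : 0 ≤ ∫ s', inducedV f (h + 1) s' ∂(M.trans h z) :=
    integral_nonneg fun s => (inducedV_mem_Icc (fun h => (hF h _ (hf h)).2) _ s).1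
  unfold bellman at h1
  linarith

lemma measurable_residual {f : Fin H → S × A × B → ℝ} (hf : ∀ h, Measurable (f h)) (h : Fin H) :
    Measurable (M.residual f h) := (hf h).sub (M.measurable_bellman hf h)

lemma residual_mem_Icc (hF : IsValueClass F) (hG : IsValueClass G) (hcomp : M.Complete F G ε)
    {f : Fin H → S × A × B → ℝ} (hf : InClass F f) (h : Fin H) (z : S × A × B) :
    M.residual f h z ∈ Set.Icc (-(1 + ε)) 1 := by
  have h1 := bellman_le hG hcomp hf h z
  have h2 := bellman_nonneg (M := M) (fun h => (hF h _ (hf h)).2) h z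
  have h3 := (hF h _ (hf h)).2 z
  constructor <;> unfold residual <;> linarith

section Approximation

variable [MeasurableSingletonClass A] [MeasurableSingletonClass B] {R : ℝ}

/-- The value functions of an approximation of `Q^⋆` approximate the Nash values. -/
lemma abs_dpV_sub_inducedV_le (hR0 : 0 ≤ R) (hR : ∀ h z, M.reward h z ≤ R)
    {f : Fin H → S × A × B → ℝ} (hε : 0 ≤ ε) (hf : ∀ h z, |M.Qstar h z - f h z| ≤ ε) (h : ℕ)
    (s : S) : |M.dpV h s - inducedV f h s| ≤ ε := by
  by_cases hh : h < H
  · rw [dpV_of_lt M hh, inducedV, dif_pos hh]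
    refine abs_matrixValue_sub_le fun a b => ?_
    rw [← Qstar_eq_dpQ hR0 hR]
    exact hf _ _
  · rw [dpV_of_le M (not_lt.1 hh), inducedV_of_le f (not_lt.1 hh)]
    simpa using hε

/-- Q⋆ is a fixed point of the Bellman backup: replacing Q⋆ by `f` costs `ε` at the current step and
`ε` in the value of the next state. -/
lemma abs_residual_le_of_approx (hR0 : 0 ≤ R) (hR : ∀ h z, M.reward h z ≤ R)
    {f : Fin H → S × A × B → ℝ} (hfm : ∀ h, Measurable (f h))
    (hf01 : ∀ h z, 0 ≤ f h z ∧ f h z ≤ 1) (hε : 0 ≤ ε)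
    (hf : ∀ h z, |M.Qstar h z - f h z| ≤ ε) (h : Fin H) (z : S × A × B) :
    |M.residual f h z| ≤ 2 * ε := by
  have h1 := hf h z
  rw [Qstar_eq_dpQ hR0 hR] at h1
  have h2 : |M.dpQ h z - M.bellman f h z| ≤ ε := by
    unfold dpQ bellman
    rw [add_sub_add_left_eq_sub, ← integral_sub
      (integrable_of_abs_le (M.measurable_dpV _) (abs_dpV_le' hR0 hR _))
      (integrable_of_abs_le (measurable_inducedV hfm _) (abs_inducedV_le hf01 _))]
    exact abs_integral_le_of_abs_le fun s => abs_dpV_sub_inducedV_le hR0 hR hε hf _ s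
  rw [abs_le] at h1 h2 ⊢
  unfold residual
  constructor <;> linarith [h1.1, h1.2, h2.1, h2.2]

/-- Policy loss decomposition: the gap between the value that `f` promises and the value that its
greedy policy obtains is at most the expected sum of Bellman residuals. -/
lemma inducedV_sub_V_le {f : Fin H → S × A × B → ℝ} (hfm : ∀ h, Measurable (f h))
    (hf01 : ∀ h z, 0 ≤ f h z ∧ f h z ≤ 1) (hR : ∀ h z, M.reward h z ≤ R)
    {μ : Policy H S A} (hμ : IsInducedPolicy f μ) (ν : Policy H S B) :
    inducedV f 0 M.init - M.V μ ν 0 M.init ≤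
      ∫ τ, ∑ h, M.residual f h (τ h) ∂(M.episodeLaw μ ν) := by
  have hb : ∀ h z, |M.residual f h z| ≤ 1 + (R + 1) := fun h z => by
    refine (abs_sub _ _).trans (add_le_add ?_ ((abs_add_le _ _).trans (add_le_add
      (abs_reward_le hR h z) (abs_integral_le_of_abs_le (abs_inducedV_le hf01 _)))))
    rw [abs_of_nonneg (hf01 h z).1]
    exact (hf01 h z).2
  -- For the rewards `reward + residual`, the one-step backup of the induced value is exactly `f`.
  -- The greedy policy secures the induced value in the matrix game `f`, so `inducedV f` is a
  -- subsolution against any `ν`.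
  have hle := le_valueOf (M := M) (μ := μ) (ν := ν)
    (ρ := fun h z => M.reward h z + M.residual f h z) (c := R + (1 + (R + 1)))
    (fun h => (M.reward_measurable h).add (measurable_residual hfm h))
    (fun h z => (abs_add_le _ _).trans (add_le_add (abs_reward_le hR h z) (hb h z)))
    (W := inducedV f) (measurable_inducedV hfm) (abs_inducedV_le hf01)
    (fun s => (inducedV_of_le f le_rfl s).le) (fun h hh s => ?_) (Nat.zero_le H) M.init
  · rw [valueOf_add M.reward_measurable (abs_reward_le hR) (measurable_residual hfm) hb,
      ← V_eq_valueOf, valueOf_zero_init] at hle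
    linarith
  · have h1 : ∀ z, M.reward ⟨h, hh⟩ z + M.residual f ⟨h, hh⟩ z +
        ∫ s', inducedV f (h + 1) s' ∂(M.trans ⟨h, hh⟩ z) = f ⟨h, hh⟩ z := fun z => by
      unfold residual bellman
      ring
    simp_rw [h1]
    rw [integral_stepKer _ _ _ _ (hfm _), inducedV, dif_pos hh]
    refine le_trans (ciSup_le fun x => hμ ⟨h, hh⟩ s x x.2) ?_
    exact guaranteed_le_payoff _ _ (probs_mem_stdSimplex ν _ _)

end Approximation

end Game

/-! ### High-probability events. -/

namespace IsOnlineRun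

variable {H : ℕ} {S A B : Type*} [Fintype A] [Fintype B] [Nonempty A] [Nonempty B]
  [MeasurableSpace S] [MeasurableSpace A] [MeasurableSpace B] {M : Game H S A B}
  {Ω : Type*} [mΩ : MeasurableSpace Ω] {P : Measure Ω} [IsProbabilityMeasure P]
  {F G : Fin H → Finset (S × A × B → ℝ)} {β : ℝ} {K : ℕ} {𝓖 : Filtration ℕ mΩ}
  {f : ℕ → Ω → Fin H → S × A × B → ℝ} {μ : ℕ → Ω → Policy H S A} {ν : ℕ → Ω → Policy H S B}
  {τ : ℕ → Ω → Fin H → S × A × B}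

/-- The one-sided Chernoff bound is applied to `w = g - T_h q` and to `-w`, whence the factor two.
The functions are fixed here; the learner's data-dependent choice is covered by a later union bound.
-/
lemma measure_not_noiseControlled_le (hrun : IsOnlineRun M P F G β K 𝓖 f μ ν τ)
    {q : Fin H → S × A × B → ℝ} (hq : ∀ h, Measurable (q h))
    (hq01 : ∀ h z, 0 ≤ q h z ∧ q h z ≤ 1) (h : Fin H) {g : S × A × B → ℝ} (hg : Measurable g)
    (L : ℝ) {k : ℕ} (hk : k ≤ K) :
    P {ω | ¬M.NoiseControlled (fun t => τ t ω) k L q h g} ≤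
      2 * ENNReal.ofReal (Real.exp (-L)) := by
  have key : ∀ w : S × A × B → ℝ, Measurable w →
      P {ω | L ≤ ∑ t ∈ Finset.range k, (2 * (w (τ t ω h) * M.valueNoise q h (τ t ω)) -
        w (τ t ω h) ^ 2 / 2)} ≤ ENNReal.ofReal (Real.exp (-L)) := by
    intro w hw
    have hwh : Measurable fun x : Fin H → S × A × B => w (x h) := hw.comp (measurable_pi_apply h)
    exact hrun.measure_le_sum_le_exp
      (u := fun x => 2 * (w (x h) * M.valueNoise q h x) - w (x h) ^ 2 / 2)
      (((hwh.mul (M.measurable_valueNoise hq h)).const_mul 2).sub ((hwh.pow_const 2).div_const 2))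
      (M.lintegral_exp_valueNoise_le hq hq01 h hw) L hk
  have hw := hg.sub (M.measurable_bellman hq h)
  refine (measure_mono fun ω hω => ?_).trans ((measure_union_le _ _).trans
    ((add_le_add (key _ hw) (key _ hw.neg)).trans_eq (two_mul _).symm))
  simp only [Game.NoiseControlled, Set.mem_ofPred_eq, not_le, lt_abs] at hω
  simp only [Set.mem_union, Set.mem_ofPred_eq, Pi.sub_apply, Pi.neg_apply, neg_sq,
    Finset.sum_sub_distrib, ← Finset.mul_sum, ← Finset.sum_div, neg_mul, Finset.sum_neg_distrib]
  obtain hω | hω := hω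
  · left; linarith
  · right; linarith

end IsOnlineRun

section Cardinality

variable {H : ℕ} {S A B : Type*}

lemma card_le_classCard {G : Fin H → Finset (S × A × B → ℝ)} (hG : ∀ h, (G h).Nonempty)
    (h : Fin H) : (G h).card ≤ classCard G :=
  Finset.single_le_prod' (f := fun h => (G h).card) (fun h _ => Finset.card_pos.2 (hG h))
    (Finset.mem_univ h)

lemma card_piFinset_eq_classCard (F : Fin H → Finset (S × A × B → ℝ)) :
    (Fintype.piFinset F).card = classCard F := Fintype.card_piFinset F

end Cardinality

section ResidualSum

variable {H : ℕ} {S A B : Type*} [Fintype A] [Fintype B]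
  [MeasurableSpace S] [MeasurableSpace A] [MeasurableSpace B] {M : Game H S A B}
  {F G : Fin H → Finset (S × A × B → ℝ)} {εcomp Λ L : ℝ}

/-- Sum of the Bellman residuals along an episode. -/
def residualSum (M : Game H S A B) (q : Fin H → S × A × B → ℝ) (x : Fin H → S × A × B) : ℝ :=
  ∑ h, M.residual q h (x h)

/-- The observed residual sums are close to their conditional means in all episodes. -/
def DeviationControlled (M : Game H S A B) (f : ℕ → Fin H → S × A × B → ℝ)
    (μ : ℕ → Policy H S A) (ν : ℕ → Policy H S B) (τ : ℕ → Fin H → S × A × B) (Λ L : ℝ) (k : ℕ) :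
    Prop :=
  ∑ t ∈ Finset.range k, (√Λ / (√k * H) *
      ((∫ x, residualSum M (f t) x ∂(M.episodeLaw (μ t) (ν t))) - residualSum M (f t) (τ t)) -
    (√Λ / (√k * H)) ^ 2 * (H - -(2 * H : ℝ)) ^ 2 / 8) < L

/-- The mean residual sums exceed the observed ones by `O(H √(k Λ))`. -/
lemma sum_integral_residualSum_le {f : ℕ → Fin H → S × A × B → ℝ}
    {μ : ℕ → Policy H S A} {ν : ℕ → Policy H S B} {τ : ℕ → Fin H → S × A × B} {k : ℕ}
    (hk : 0 < k) (hH : 0 < H) (hΛ : 0 < Λ) (hL : L ≤ 4 * Λ)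
    (hdev : DeviationControlled M f μ ν τ Λ L k) :
    ∑ t ∈ Finset.range k, ∫ x, residualSum M (f t) x ∂(M.episodeLaw (μ t) (ν t)) ≤
      ∑ t ∈ Finset.range k, residualSum M (f t) (τ t) + 41 / 8 * (H * √(k * Λ)) := by
  have hk' : (0 : ℝ) < √k := Real.sqrt_pos.2 (by exact_mod_cast hk)
  have hΛ' : (0 : ℝ) < √Λ := Real.sqrt_pos.2 hΛ
  have hH' : (0 : ℝ) < H := by exact_mod_cast hH
  have hk2 : √(k : ℝ) ^ 2 = k := Real.sq_sqrt (Nat.cast_nonneg k)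
  have hΛ2 : √Λ ^ 2 = Λ := Real.sq_sqrt hΛ.le
  unfold DeviationControlled at hdev
  rw [Finset.sum_sub_distrib, ← Finset.mul_sum, Finset.sum_sub_distrib, Finset.sum_const,
    Finset.card_range, nsmul_eq_mul] at hdev
  set D := ∑ t ∈ Finset.range k, ∫ x, residualSum M (f t) x ∂(M.episodeLaw (μ t) (ν t))
  set O := ∑ t ∈ Finset.range k, residualSum M (f t) (τ t)
  -- Residual sums range over an interval of length `3 * H`, so the compensator totals `9 / 8 * Λ`.
  -- With `L ≤ 4 * Λ` this makes `41 / 8 * Λ`, and dividing by the Chernoff parameter `√Λ / (√k *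
  -- H)` gives `41 / 8 * H * √(k * Λ)`.
  have h1 : (k : ℝ) * ((√Λ / (√k * H)) ^ 2 * (H - -(2 * H : ℝ)) ^ 2 / 8) = 9 / 8 * Λ := by
    rw [div_pow, mul_pow, hΛ2, hk2]
    field_simp
    ring
  rw [h1] at hdev
  have h2 : √Λ / (√k * H) * (D - O) ≤ 41 / 8 * √Λ ^ 2 := by rw [hΛ2]; linarith
  have h3 : D - O ≤ 41 / 8 * (H * (√k * √Λ)) := by
    have h4 : √Λ / (√k * H) * (D - O) = √Λ * ((D - O) / (√k * H)) := by ring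
    have h5 : √Λ * ((D - O) / (√k * H)) ≤ √Λ * (41 / 8 * √Λ) := by
      rw [← h4]; linarith
    have h6 := le_of_mul_le_mul_left h5 hΛ'
    rw [div_le_iff₀ (by positivity)] at h6
    linarith
  rw [Real.sqrt_mul (Nat.cast_nonneg k)]
  linarith

variable [Nonempty A] [Nonempty B]

lemma residualSum_mem_Icc (hF : IsValueClass F) (hG : IsValueClass G)
    (hcomp : M.Complete F G εcomp) (hε : εcomp ≤ 1) {q : Fin H → S × A × B → ℝ}
    (hq : InClass F q) (x : Fin H → S × A × B) :
    residualSum M q x ∈ Set.Icc (-(2 * H : ℝ)) H := by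
  have h1 := fun h => Game.residual_mem_Icc hF hG hcomp hq h (x h)
  constructor
  · have := Finset.card_nsmul_le_sum Finset.univ (fun h => M.residual q h (x h)) (-2)
      fun h _ => by linarith [(h1 h).1]
    simp only [Finset.card_univ, Fintype.card_fin, nsmul_eq_mul] at this
    unfold residualSum
    linarith
  · have := Finset.sum_le_card_nsmul Finset.univ (fun h => M.residual q h (x h)) 1
      fun h _ => (h1 h).2
    simpa [residualSum] using this

end ResidualSum

namespace IsOnlineRun

variable {H : ℕ} {S A B : Type*} [Fintype A] [Fintype B] [Nonempty A] [Nonempty B]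
  [MeasurableSpace S] [MeasurableSpace A] [MeasurableSpace B]
  {M : Game H S A B}
  {Ω : Type*} [mΩ : MeasurableSpace Ω] {P : Measure Ω} [IsProbabilityMeasure P]
  {F G : Fin H → Finset (S × A × B → ℝ)} {β : ℝ} {K : ℕ} {𝓖 : Filtration ℕ mΩ}
  {f : ℕ → Ω → Fin H → S × A × B → ℝ} {μ : ℕ → Ω → Policy H S A} {ν : ℕ → Ω → Policy H S B}
  {τ : ℕ → Ω → Fin H → S × A × B} {εcomp : ℝ}

/-- With high probability the regression noise is controlled for all functions, steps and
episodes. -/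
lemma measure_not_forall_noiseControlled_le (hrun : IsOnlineRun M P F G β K 𝓖 f μ ν τ)
    (hF : IsValueClass F) (hG : IsValueClass G) (hG0 : ∀ h, (G h).Nonempty) (L : ℝ) :
    P {ω | ¬∀ q, InClass F q → ∀ h, ∀ g, g = q h ∨ g ∈ G h → ∀ k < K,
      M.NoiseControlled (fun t => τ t ω) k L q h g} ≤
      (4 * (K * H * classCard F * classCard G) : ℕ) * ENNReal.ofReal (Real.exp (-L)) := by
  classical
  -- The count is `|F| · H · 2|G| · K · 2`: the first two accounts for `q h` joining `G h`, the
  -- second for the two tails.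
  have h1 := measure_not_forall_le (P := P) (Fintype.piFinset F)
    (fun q ω => ∀ h ∈ (Finset.univ : Finset (Fin H)), ∀ g ∈ insert (q h) (G h),
      ∀ k ∈ Finset.range K, M.NoiseControlled (fun t => τ t ω) k L q h g)
    (e := ((Finset.univ : Finset (Fin H)).card : ℝ≥0∞) * ((2 * classCard G : ℕ) *
      ((Finset.range K).card * (2 * ENNReal.ofReal (Real.exp (-L)))))) fun q hq => by
    have hq : InClass F q := fun h => Fintype.mem_piFinset.1 hq h
    refine measure_not_forall_le _ _ fun h _ => ?_
    refine (measure_not_forall_le (e := (Finset.range K).card *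
      (2 * ENNReal.ofReal (Real.exp (-L)))) _ _ fun g hg => ?_).trans
      (mul_le_mul_left ?_ _)
    · refine measure_not_forall_le _ _ fun k hk => ?_
      have hgm : Measurable g := by
        obtain rfl | hg := Finset.mem_insert.1 hg
        · exact (hF h _ (hq h)).1
        · exact (hG h g hg).1
      exact hrun.measure_not_noiseControlled_le (fun h => (hF h _ (hq h)).1)
        (fun h => (hF h _ (hq h)).2) h hgm L (Finset.mem_range.1 hk).le
    · have h2 := Finset.card_insert_le (q h) (G h)
      have h3 := card_le_classCard hG0 h
      have h4 := (Finset.card_pos.2 (hG0 h)).trans_le h3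
      exact_mod_cast (show _ ≤ 2 * classCard G by omega)
  refine le_trans (measure_mono fun ω hω => ?_) (h1.trans_eq ?_)
  · intro hgood
    refine hω fun q hq h g hg k hk => hgood q (Fintype.mem_piFinset.2 hq) h (Finset.mem_univ h) g
      (Finset.mem_insert.2 hg) k (Finset.mem_range.2 hk)
  · rw [card_piFinset_eq_classCard, Finset.card_univ, Fintype.card_fin, Finset.card_range]
    push_cast
    ring

/-- Only a union over `k` is needed, because the Chernoff parameter depends on `k`. The choice of `f
t` is fixed by the past, so the class adds no factor. -/
lemma measure_not_forall_deviationControlled_le (hrun : IsOnlineRun M P F G β K 𝓖 f μ ν τ)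
    (hF : IsValueClass F) (hG : IsValueClass G) (hcomp : M.Complete F G εcomp) (hε : εcomp ≤ 1)
    (Λ L : ℝ) :
    P {ω | ¬∀ k ∈ Finset.Icc 1 K, DeviationControlled M (fun t => f t ω) (fun t => μ t ω)
      (fun t => ν t ω) (fun t => τ t ω) Λ L k} ≤ K * ENNReal.ofReal (Real.exp (-L)) := by
  refine (measure_not_forall_le _ _ fun k hk => ?_).trans_eq
    (by rw [Nat.card_Icc, Nat.add_sub_cancel])
  simp only [DeviationControlled, not_lt]
  refine hrun.measure_le_sum_deviation_le_exp (R := residualSum M) (fun q hq => ?_)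
    (fun q hq => residualSum_mem_Icc hF hG hcomp hε hq) _ L (Finset.mem_Icc.1 hk).2
  exact Finset.measurable_sum _ fun h _ =>
    (Game.measurable_residual (fun h => (hF h _ (hq h)).1) h).comp (measurable_pi_apply h)

end IsOnlineRun

/-! ### The regret bound. -/

namespace IsOnlineRun

variable {H : ℕ} {S A B : Type*} [Fintype A] [Fintype B] [Nonempty A] [Nonempty B]
  [MeasurableSpace S] [MeasurableSpace A] [MeasurableSpace B]
  [MeasurableSingletonClass A] [MeasurableSingletonClass B]
  {M : Game H S A B}
  {Ω : Type*} [mΩ : MeasurableSpace Ω] {P : Measure Ω}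
  {F G : Fin H → Finset (S × A × B → ℝ)} {β : ℝ} {K : ℕ} {𝓖 : Filtration ℕ mΩ}
  {f : ℕ → Ω → Fin H → S × A × B → ℝ} {μ : ℕ → Ω → Policy H S A} {ν : ℕ → Ω → Policy H S B}
  {τ : ℕ → Ω → Fin H → S × A × B} {εreal εcomp : ℝ} {d : ℕ} {fstar : Fin H → S × A × B → ℝ}

lemma Vstar_init_le (hF : IsValueClass F) (hG : IsValueClass G) (hcomp : M.Complete F G εcomp)
    (hr0 : 0 ≤ εreal) (hc0 : 0 ≤ εcomp) (hstar : InClass F fstar)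
    (hreal : ∀ h z, |M.Qstar h z - fstar h z| ≤ εreal) :
    M.Vstar 0 M.init ≤ inducedV fstar 0 M.init + εreal := by
  have hR := Game.reward_le hF hG hcomp hstar
  have h1 := Game.abs_dpV_sub_inducedV_le (by positivity) hR hr0 hreal 0 M.init
  rw [Game.Vstar_eq_dpV (by positivity) hR]
  linarith [(abs_le.1 h1).2]

/-- The regret of one episode is at most a constant. -/
lemma regret_le_one_add (hF : IsValueClass F) (hG : IsValueClass G)
    (hcomp : M.Complete F G εcomp) (hr0 : 0 ≤ εreal) (hc0 : 0 ≤ εcomp) (hstar : InClass F fstar)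
    (hreal : ∀ h z, |M.Qstar h z - fstar h z| ≤ εreal) (μ : Policy H S A) (ν : Policy H S B) :
    M.Vstar 0 M.init - M.V μ ν 0 M.init ≤ 1 + εreal := by
  have h1 := Vstar_init_le hF hG hcomp hr0 hc0 hstar hreal
  have h2 := (inducedV_mem_Icc (fun h => (hF h _ (hstar h)).2) 0 M.init).2
  have h3 := Game.V_nonneg (M := M) μ ν 0 M.init
  linarith

/-- The regret of one optimistic episode is at most the mean sum of residuals. -/
lemma regret_le_integral_residualSum (hrun : IsOnlineRun M P F G β K 𝓖 f μ ν τ)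
    (hF : IsValueClass F) (hG : IsValueClass G) (hcomp : M.Complete F G εcomp)
    (hr0 : 0 ≤ εreal) (hc0 : 0 ≤ εcomp) (hstar : InClass F fstar)
    (hreal : ∀ h z, |M.Qstar h z - fstar h z| ≤ εreal) {t : ℕ} (ht : t < K) (ω : Ω)
    (hopt : inducedV fstar 0 M.init ≤ inducedV (f t ω) 0 M.init) :
    M.Vstar 0 M.init - M.V (μ t ω) (ν t ω) 0 M.init ≤
      εreal + ∫ x, residualSum M (f t ω) x ∂(M.episodeLaw (μ t ω) (ν t ω)) := by
  have h1 := Vstar_init_le hF hG hcomp hr0 hc0 hstar hreal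
  have hq := hrun.f_mem t ht ω
  have h2 := Game.inducedV_sub_V_le (fun h => (hF h _ (hq h)).1) (fun h => (hF h _ (hq h)).2)
    (Game.reward_le hF hG hcomp hstar) (hrun.greedy t ht ω) (ν t ω)
  unfold residualSum
  linarith

/-- A class with a single function leaves only the approximation error. -/
lemma regret_le_of_singleton (hrun : IsOnlineRun M P F G β K 𝓖 f μ ν τ)
    (hF : IsValueClass F) (hG : IsValueClass G) (hcomp : M.Complete F G εcomp)
    (hr0 : 0 ≤ εreal) (hc0 : 0 ≤ εcomp) (hstar : InClass F fstar)
    (hreal : ∀ h z, |M.Qstar h z - fstar h z| ≤ εreal) (hcard : classCard F = 1) {t : ℕ}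
    (ht : t < K) (ω : Ω) :
    M.Vstar 0 M.init - M.V (μ t ω) (ν t ω) 0 M.init ≤ (1 + 2 * H) * εreal := by
  have heq : f t ω = fstar := by
    rw [← card_piFinset_eq_classCard] at hcard
    exact Finset.card_le_one.1 hcard.le _ (Fintype.mem_piFinset.2 (hrun.f_mem t ht ω)) _
      (Fintype.mem_piFinset.2 hstar)
  have h1 := regret_le_integral_residualSum hrun hF hG hcomp hr0 hc0 hstar hreal ht ω
    (by rw [heq])
  have h2 : ∀ x, |residualSum M (f t ω) x| ≤ H * (2 * εreal) := by
    intro x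
    rw [heq]
    refine (Finset.abs_sum_le_sum_abs _ _).trans ((Finset.sum_le_card_nsmul _ _ _ fun h _ =>
      Game.abs_residual_le_of_approx (by positivity) (Game.reward_le hF hG hcomp hstar)
        (fun h => (hF h _ (hstar h)).1) (fun h => (hF h _ (hstar h)).2) hr0 hreal h _).trans_eq ?_)
    simp
  have h3 := (abs_le.1 (abs_integral_le_of_abs_le
    (m := M.episodeLaw (μ t ω) (ν t ω)) h2)).2
  linarith

/-- The regret bound on the event that the noise and the deviations are controlled. -/
theorem regret_le_of_controlled (hrun : IsOnlineRun M P F G β K 𝓖 f μ ν τ)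
    (hF : IsValueClass F) (hG : IsValueClass G) (hcomp : M.Complete F G εcomp)
    (hr0 : 0 ≤ εreal) (hc0 : 0 ≤ εcomp) (hc1 : εcomp ≤ 1) (hstar : InClass F fstar)
    (hreal : ∀ h z, |M.Qstar h z - fstar h z| ≤ εreal) (hG0 : ∀ h, (G h).Nonempty)
    (hd : M.dimOBE F (1 / K) = d) (hH : 0 < H) {Λ L : ℝ} (hΛ : 1 / 2 ≤ Λ) (hL : L ≤ 4 * Λ)
    (hβ : β = 8 * (Λ + K * εcomp ^ 2 + K * εreal ^ 2)) {ω : Ω}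
    (hnoise : ∀ q, InClass F q → ∀ h, ∀ g, g = q h ∨ g ∈ G h → ∀ k < K,
      M.NoiseControlled (fun t => τ t ω) k L q h g)
    (hdev : ∀ k ∈ Finset.Icc 1 K, DeviationControlled M (fun t => f t ω) (fun t => μ t ω)
      (fun t => ν t ω) (fun t => τ t ω) Λ L k) {k : ℕ} (hk : k ≤ K) :
    ∑ t ∈ Finset.range k, (M.Vstar 0 M.init - M.V (μ t ω) (ν t ω) 0 M.init) ≤
      10 * H * √(max (d : ℝ) 1 * k * β) := by
  obtain rfl | hk0 := Nat.eq_zero_or_pos k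
  · simp
  have hK0 : 0 < K := hk0.trans_le hk
  have hkK : (k : ℝ) ≤ K := by exact_mod_cast hk
  have hkr : (1 : ℝ) ≤ k := by exact_mod_cast hk0
  have hHr : (1 : ℝ) ≤ H := by exact_mod_cast hH
  have hεc : 0 ≤ K * εcomp ^ 2 := by positivity
  have hεr : 0 ≤ K * εreal ^ 2 := by positivity
  have hβ4 : 4 ≤ β := by linarith
  have hres := Game.abs_residual_le_of_approx (M := M) (by positivity)
    (Game.reward_le hF hG hcomp hstar) (fun h => (hF h _ (hstar h)).1)
    (fun h => (hF h _ (hstar h)).2) hr0 hreal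
  have hscale : ∀ t < K, ∀ e : ℝ, (t : ℝ) * e ^ 2 ≤ K * e ^ 2 := fun t ht e =>
    mul_le_mul_of_nonneg_right (by exact_mod_cast ht.le) (sq_nonneg e)
  have hconf : ∀ t < K, f t ω ∈ M.confSet F G β (fun t => τ t ω) t ∧
      inducedV fstar 0 M.init ≤ inducedV (f t ω) 0 M.init := by
    intro t ht
    have hmem : fstar ∈ M.confSet F G β (fun t => τ t ω) t := by
      refine Game.mem_confSet hG0 hstar hres
        (fun h g hg => hnoise fstar hstar h g hg t ht) ?_
      -- Residuals of `fstar` are at most `2 * εreal`, so membership costs `6 * K * εreal ^ 2 + 2 *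
      -- L`; with `L ≤ 4 * Λ` this fits into `β`.
      have := hscale t ht (2 * εreal)
      rw [mul_pow] at this ⊢
      linarith
    obtain ⟨h1, h2⟩ := hrun.optimistic t ht ω ⟨_, hmem⟩
    exact ⟨h1, h2 _ hmem⟩
  have hsq : ∀ h, ∀ t < K, ∑ i ∈ Finset.range t, M.residual (f t ω) h (τ i ω h) ^ 2 ≤ 4 * β := by
    intro h t ht
    -- Noise control on no data at all reads `0 ≤ L`.
    have hLnn : 0 ≤ L := by
      have := hnoise fstar hstar h _ (Or.inl rfl) 0 hK0
      simpa [Game.NoiseControlled] using this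
    refine (Game.sum_residual_sq_le hcomp (hconf t ht).1
      (fun h g hg => hnoise _ (hrun.f_mem t ht ω) h g hg t ht) (by positivity) h).trans ?_
    -- Here `3 * K * εcomp ^ 2 + 4 * L ≤ 2 * β`, using `4 * L ≤ 16 * Λ`.
    linarith [hscale t ht εcomp]
  set X := √(max (d : ℝ) 1 * k * β) with hX
  have hd1 : (1 : ℝ) ≤ max (d : ℝ) 1 := le_max_right _ _
  have hdd : (d : ℝ) ≤ max (d : ℝ) 1 := le_max_left _ _
  have hXkβ : (k : ℝ) * β ≤ max (d : ℝ) 1 * k * β := by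
    rw [mul_assoc]; exact le_mul_of_one_le_left (by positivity) hd1
  have hXdkβ : (d : ℝ) * k * β ≤ max (d : ℝ) 1 * k * β := by gcongr
  have hX1 : 1 ≤ X := Real.one_le_sqrt.2 (by nlinarith)
  have hsum : ∀ h, ∑ t ∈ Finset.range k, M.residual (f t ω) h (τ t ω h) ≤ 7 * X := by
    intro h
    refine (Finset.sum_le_sum fun t _ => le_abs_self _).trans ?_
    have hdim : dimDE (M.residuals F h) (Set.range Measure.dirac) (1 / K) ≤ d := by
      rw [← hd]
      exact le_iSup (fun h => dimDE (M.residuals F h)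
        (Set.range (Measure.dirac : S × A × B → Measure (S × A × B))) (1 / K)) h
    have hmeas : ∀ g ∈ M.residuals F h, Measurable g := by
      rintro _ ⟨q, hq, rfl⟩
      exact Game.measurable_residual (fun h => (hF h _ (hq h)).1) h
    -- The three terms are at most `X`, `2 * X` and `4 * X`: resolution `1 / K` costs at most `1`,
    -- `min d k ≤ √(d * k)`, and the squared residuals sum to at most `4 * β`.
    have key := sum_abs_le_of_dimDE hmeas hdim (φ := fun t => M.residual (f t ω) h)
      (z := fun t => τ t ω h) (k := k) (fun t ht => ⟨_, hrun.f_mem t (ht.trans_le hk) ω, rfl⟩)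
      (b := 4 * β) (c := 2) (by positivity) (by positivity)
      (fun t ht => hsq h t (ht.trans_le hk)) zero_le_two (fun t ht => by
        have := Game.residual_mem_Icc hF hG hcomp (hrun.f_mem t (ht.trans_le hk) ω) h (τ t ω h)
        exact abs_le.2 ⟨by linarith [this.1], by linarith [this.2]⟩)
    have h1 : (k : ℝ) * (1 / K) ≤ 1 := by
      rw [mul_one_div]; exact div_le_one_of_le₀ hkK (by positivity)
    have h2 : ((min d k : ℕ) : ℝ) ≤ X := by
      refine Real.le_sqrt_of_sq_le (le_trans ?_ hXdkβ)
      have hm1 : ((min d k : ℕ) : ℝ) ≤ d := by exact_mod_cast min_le_left d k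
      have hm2 : ((min d k : ℕ) : ℝ) ≤ k := by exact_mod_cast min_le_right d k
      rw [sq]
      calc ((min d k : ℕ) : ℝ) * (min d k : ℕ) ≤ d * k := by gcongr
        _ ≤ d * k * β := le_mul_of_one_le_right (by positivity) (by linarith)
    have h3 : √(4 * β * d * k) ≤ 2 * X := by
      rw [show 4 * β * d * k = 2 ^ 2 * (d * k * β) by ring, Real.sqrt_mul (by positivity),
        Real.sqrt_sq zero_le_two]
      exact mul_le_mul_of_nonneg_left (Real.sqrt_le_sqrt hXdkβ) zero_le_two
    linarith
  have hΛX : 41 / 8 * √(k * Λ) ≤ 2 * X := by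
    have h1 : √(8 * (k * Λ)) ≤ X := by
      refine Real.sqrt_le_sqrt (le_trans ?_ hXkβ)
      rw [mul_left_comm]
      exact mul_le_mul_of_nonneg_left (by linarith) (by positivity)
    have h2 : √(((41 : ℝ) / 16) ^ 2) * √(k * Λ) ≤ √(8 * (k * Λ)) := by
      rw [← Real.sqrt_mul (by positivity)]
      exact Real.sqrt_le_sqrt (mul_le_mul_of_nonneg_right (by norm_num) (by positivity))
    rw [Real.sqrt_sq (by norm_num)] at h2
    linarith
  have hεX : k * εreal ≤ X := by
    refine Real.le_sqrt_of_sq_le (le_trans ?_ hXkβ)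
    rw [mul_pow, sq, mul_assoc]
    refine mul_le_mul_of_nonneg_left ?_ (by positivity)
    have : (k : ℝ) * εreal ^ 2 ≤ K * εreal ^ 2 := by gcongr
    linarith
  have hreg : ∑ t ∈ Finset.range k, (M.Vstar 0 M.init - M.V (μ t ω) (ν t ω) 0 M.init) ≤
      k * εreal + ∑ t ∈ Finset.range k,
        ∫ x, residualSum M (f t ω) x ∂(M.episodeLaw (μ t ω) (ν t ω)) := by
    refine (Finset.sum_le_sum (g := fun t => εreal +
      ∫ x, residualSum M (f t ω) x ∂(M.episodeLaw (μ t ω) (ν t ω))) fun t ht => ?_).trans_eq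
      (by rw [Finset.sum_add_distrib]; simp)
    have ht := (Finset.mem_range.1 ht).trans_le hk
    exact regret_le_integral_residualSum hrun hF hG hcomp hr0 hc0 hstar hreal ht ω (hconf t ht).2
  have hdevk := sum_integral_residualSum_le hk0 hH (by linarith) hL
    (hdev k (Finset.mem_Icc.2 ⟨hk0, hk⟩))
  have hobs : ∑ t ∈ Finset.range k, residualSum M (f t ω) (τ t ω) ≤ H * (7 * X) := by
    unfold residualSum
    rw [Finset.sum_comm]
    refine (Finset.sum_le_card_nsmul _ _ _ fun h _ => hsum h).trans_eq ?_
    simp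
  have hΛX' : 41 / 8 * (H * √(k * Λ)) ≤ H * (2 * X) := by
    rw [mul_left_comm]
    exact mul_le_mul_of_nonneg_left hΛX (by positivity)
  have hXH : X ≤ H * X := le_mul_of_one_le_left (by positivity) hHr
  -- Approximation, observed residuals and deviation contribute `1`, `7` and `2` times `H * X`.
  linarith

/-- With constant misspecification the regret bound is trivial. -/
lemma regret_le_of_one_lt (hF : IsValueClass F) (hG : IsValueClass G)
    (hcomp : M.Complete F G εcomp) (hr0 : 0 ≤ εreal) (hc1 : 1 < εcomp) (hstar : InClass F fstar)
    (hreal : ∀ h z, |M.Qstar h z - fstar h z| ≤ εreal) (hH : 0 < H) {Λ : ℝ} (hΛ : 0 ≤ Λ)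
    (hβ : β = 8 * (Λ + K * εcomp ^ 2 + K * εreal ^ 2)) (μ : ℕ → Policy H S A)
    (ν : ℕ → Policy H S B) {k : ℕ} (hk : k ≤ K) :
    ∑ t ∈ Finset.range k, (M.Vstar 0 M.init - M.V (μ t) (ν t) 0 M.init) ≤
      10 * H * √(max (d : ℝ) 1 * k * β) := by
  have hkK : (k : ℝ) ≤ K := by exact_mod_cast hk
  have hHr : (1 : ℝ) ≤ H := by exact_mod_cast hH
  have hK1 : (K : ℝ) ≤ K * εcomp ^ 2 :=
    le_mul_of_one_le_right (by positivity) (one_le_pow₀ hc1.le)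
  have hεr : 0 ≤ K * εreal ^ 2 := by positivity
  have hεc : 0 ≤ K * εcomp ^ 2 := by positivity
  have hβ0 : 0 ≤ β := by rw [hβ]; positivity
  set X := √(max (d : ℝ) 1 * k * β) with hX
  have hXkβ : (k : ℝ) * β ≤ max (d : ℝ) 1 * k * β := by
    rw [mul_assoc]; exact le_mul_of_one_le_left (by positivity) (le_max_right _ _)
  -- Since `εcomp > 1`, `β ≥ 8 * K ≥ k`, so the bound already exceeds the number of episodes.
  have h1 : (k : ℝ) ≤ X := by
    refine Real.le_sqrt_of_sq_le (le_trans ?_ hXkβ)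
    rw [sq]
    exact mul_le_mul_of_nonneg_left (by linarith) (by positivity)
  have hεX : k * εreal ≤ X := by
    refine Real.le_sqrt_of_sq_le (le_trans ?_ hXkβ)
    rw [mul_pow, sq, mul_assoc]
    refine mul_le_mul_of_nonneg_left ?_ (by positivity)
    have : (k : ℝ) * εreal ^ 2 ≤ K * εreal ^ 2 := by gcongr
    linarith
  have h2 := Finset.sum_le_card_nsmul (Finset.range k)
    (fun t => M.Vstar 0 M.init - M.V (μ t) (ν t) 0 M.init) (1 + εreal) fun t _ =>
      regret_le_one_add hF hG hcomp hr0 (by linarith) hstar hreal (μ t) (ν t)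
  rw [Finset.card_range, nsmul_eq_mul] at h2
  have hXH : X ≤ H * X := le_mul_of_one_le_left (by positivity) hHr
  have hX0 : 0 ≤ X := by positivity
  linarith

end IsOnlineRun

lemma ofReal_one_sub_le_measure {Ω : Type*} [MeasurableSpace Ω] {P : Measure Ω}
    [IsProbabilityMeasure P] {s : Set Ω} {δ : ℝ} (hδ : 0 ≤ δ)
    (h : P sᶜ ≤ ENNReal.ofReal δ) : ENNReal.ofReal (1 - δ) ≤ P s := by
  rw [ENNReal.ofReal_sub _ hδ, ENNReal.ofReal_one, tsub_le_iff_right]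
  calc (1 : ℝ≥0∞) = P Set.univ := measure_univ.symm
    _ ≤ P (s ∪ sᶜ) := by rw [Set.union_compl_self]
    _ ≤ P s + P sᶜ := measure_union_le _ _
    _ ≤ _ := by gcongr

namespace IsOnlineRun

variable {H : ℕ} {S A B : Type*} [Fintype A] [Fintype B] [Nonempty A] [Nonempty B]
  [MeasurableSpace S] [MeasurableSpace A] [MeasurableSpace B]
  [MeasurableSingletonClass A] [MeasurableSingletonClass B]
  {M : Game H S A B}
  {Ω : Type*} [mΩ : MeasurableSpace Ω] {P : Measure Ω} [IsProbabilityMeasure P]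
  {F G : Fin H → Finset (S × A × B → ℝ)} {β : ℝ} {K : ℕ} {𝓖 : Filtration ℕ mΩ}
  {f : ℕ → Ω → Fin H → S × A × B → ℝ} {μ : ℕ → Ω → Policy H S A} {ν : ℕ → Ω → Policy H S B}
  {τ : ℕ → Ω → Fin H → S × A × B} {εreal εcomp δ : ℝ} {d : ℕ}

/-- High-probability regret bound of the optimistic learner for games with at least one step. -/
theorem regret_le (hrun : IsOnlineRun M P F G β K 𝓖 f μ ν τ)
    (hF : IsValueClass F) (hG : IsValueClass G) (hreal : M.Realizable F εreal)
    (hcomp : M.Complete F G εcomp) (hδ0 : 0 < δ) (hδ1 : δ ≤ 1) (hH : 0 < H) (hK : 0 < K)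
    (hβ : β = 8 * (Real.log (K * H * classCard F * classCard G / δ)
      + K * εcomp ^ 2 + K * εreal ^ 2))
    (hd : M.dimOBE F (1 / K) = d) :
    ENNReal.ofReal (1 - δ) ≤ P {ω | ∀ k ≤ K,
      ∑ t ∈ Finset.range k, (M.Vstar 0 M.init - M.V (μ t ω) (ν t ω) 0 M.init) ≤
        10 * H * √(max (d : ℝ) 1 * k * β)} := by
  choose fstar hstar happ using hreal
  obtain ⟨g, hg, hgε⟩ : ∃ g : Fin H → S × A × B → ℝ, (∀ h, g h ∈ G h) ∧
      ∀ h z, |M.bellman fstar h z - g h z| ≤ εcomp := by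
    choose g hg hgε using hcomp fstar hstar
    exact ⟨g, hg, hgε⟩
  have hF0 : ∀ h, (F h).Nonempty := fun h => ⟨_, hstar h⟩
  have hG0 : ∀ h, (G h).Nonempty := fun h => ⟨_, hg h⟩
  let z : S × A × B := (M.init, Classical.arbitrary A, Classical.arbitrary B)
  have hr0 : 0 ≤ εreal := (abs_nonneg _).trans (happ ⟨0, hH⟩ z)
  have hc0 : 0 ≤ εcomp := (abs_nonneg _).trans (hgε ⟨0, hH⟩ z)
  have hcF : 0 < classCard F := Finset.prod_pos fun h _ => Finset.card_pos.2 (hF0 h)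
  have hcG : 0 < classCard G := Finset.prod_pos fun h _ => Finset.card_pos.2 (hG0 h)
  set n : ℕ := K * H * classCard F * classCard G with hn
  have hn0 : 0 < n := by positivity
  have hncast : (K * H * classCard F * classCard G : ℝ) = n := by rw [hn]; push_cast; rfl
  rw [hncast] at hβ
  have hn1 : (1 : ℝ) ≤ n := by exact_mod_cast hn0
  have hnδ : (n : ℝ) ≤ n / δ := by
    rw [le_div_iff₀ hδ0]; exact mul_le_of_le_one_right (by positivity) hδ1
  have hΛ0 : 0 ≤ Real.log (n / δ) := Real.log_nonneg (hn1.trans hnδ)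
  -- The range of the residual sums used for the deviations requires `εcomp ≤ 1`.
  obtain hc1 | hc1 := lt_or_ge 1 εcomp
  · refine ofReal_one_sub_le_measure hδ0.le ?_
    rw [show {ω | ∀ k ≤ K, ∑ t ∈ Finset.range k,
        (M.Vstar 0 M.init - M.V (μ t ω) (ν t ω) 0 M.init) ≤
        10 * H * √(max (d : ℝ) 1 * k * β)} = Set.univ from Set.eq_univ_of_forall fun ω k hk =>
      regret_le_of_one_lt hF hG hcomp hr0 hc1 hstar happ hH hΛ0 hβ _ _ hk]
    simp
  -- For `n = 1` and `δ = 1` the logarithm is zero and cannot absorb constants. Then `H = K = 1` and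
  -- F is a single function, so only the approximation error remains.
  obtain hn2 | hn2 := Nat.lt_or_ge n 2
  · have hn1 : n = 1 := by omega
    rw [hn] at hn1
    obtain ⟨⟨⟨hK1, hH1⟩, hcF1⟩, -⟩ : ((K = 1 ∧ H = 1) ∧ classCard F = 1) ∧ classCard G = 1 := by
      simpa only [mul_eq_one] using hn1
    refine ofReal_one_sub_le_measure hδ0.le ?_
    rw [show {ω | ∀ k ≤ K, ∑ t ∈ Finset.range k,
        (M.Vstar 0 M.init - M.V (μ t ω) (ν t ω) 0 M.init) ≤
        10 * H * √(max (d : ℝ) 1 * k * β)} = Set.univ from Set.eq_univ_of_forall fun ω k hk => ?_]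
    · simp
    · obtain rfl | rfl : k = 0 ∨ k = 1 := by omega
      · simp
      have h1 := regret_le_of_singleton hrun hF hG hcomp hr0 hc0 hstar happ hcF1
        (t := 0) hK ω
      have h2 : εreal ≤ √(max (d : ℝ) 1 * (1 : ℕ) * β) := by
        refine Real.le_sqrt_of_sq_le ?_
        have hβr : εreal ^ 2 ≤ β := by
          rw [hβ, hK1, Nat.cast_one, one_mul, one_mul]
          linarith [sq_nonneg εcomp, sq_nonneg εreal]
        rw [Nat.cast_one, mul_one]
        exact hβr.trans (le_mul_of_one_le_left ((sq_nonneg _).trans hβr) (le_max_right _ _))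
      rw [Finset.sum_range_one]
      have hHr : (H : ℝ) = 1 := by exact_mod_cast hH1
      rw [hHr] at h1 ⊢
      linarith
  have hlog2 := Real.log_two_gt_d9
  have hn2r : (2 : ℝ) ≤ n := by exact_mod_cast hn2
  have hΛ2 : Real.log 2 ≤ Real.log (n / δ) := Real.log_le_log two_pos (hn2r.trans hnδ)
  set Λ := Real.log (n / δ) with hΛ
  -- The factor `8 = 2 ^ 3` adds `3 * log 2 ≤ 3 * Λ`. It is chosen so that the failure probability
  -- `(4 * n + K) * δ / (8 * n)` is below `δ`.
  have hL : Real.log (8 * (n / δ)) ≤ 4 * Λ := by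
    rw [Real.log_mul (by norm_num) (by positivity), show (8 : ℝ) = 2 ^ 3 by norm_num, Real.log_pow]
    push_cast
    linarith
  set L := Real.log (8 * (n / δ)) with hLdef
  have hexp : Real.exp (-L) = δ / (8 * n) := by
    rw [Real.exp_neg, hLdef, Real.exp_log (by positivity)]
    field_simp
  refine ofReal_one_sub_le_measure hδ0.le ?_
  refine (measure_mono (t := {ω | ¬∀ q, InClass F q → ∀ h, ∀ g, g = q h ∨ g ∈ G h → ∀ k < K,
      M.NoiseControlled (fun t => τ t ω) k L q h g} ∪
      {ω | ¬∀ k ∈ Finset.Icc 1 K, DeviationControlled M (fun t => f t ω) (fun t => μ t ω)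
        (fun t => ν t ω) (fun t => τ t ω) Λ L k}) fun ω hω => ?_).trans
    ((measure_union_le _ _).trans ((add_le_add
      (hrun.measure_not_forall_noiseControlled_le hF hG hG0 L)
      (hrun.measure_not_forall_deviationControlled_le hF hG hcomp hc1 Λ L)).trans ?_))
  · by_contra hgood
    simp only [Set.mem_union, Set.mem_ofPred_eq, not_or, not_not] at hgood
    exact hω fun k hk => regret_le_of_controlled hrun hF hG hcomp hr0 hc0 hc1 hstar happ hG0 hd hH
      (by linarith) hL hβ hgood.1 hgood.2 hk
  · rw [← hn, ← add_mul, ← ENNReal.ofReal_natCast, ← ENNReal.ofReal_natCast,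
      ← ENNReal.ofReal_add (by positivity) (by positivity), ← ENNReal.ofReal_mul (by positivity)]
    refine ENNReal.ofReal_le_ofReal ?_
    have hKn : (K : ℝ) ≤ n := by
      have : K ≤ n := by
        rw [hn, mul_assoc, mul_assoc]
        exact Nat.le_mul_of_pos_right K (by positivity)
      exact_mod_cast this
    rw [hexp, ← mul_div_assoc, div_le_iff₀ (by positivity)]
    push_cast
    nlinarith

end IsOnlineRun

end MarkovGames

end

/-! ### The theorem with explicit constants. -/

theorem theorem3 :
    ∃ c : ℝ, 0 < c ∧ ∃ C : ℝ, 0 < C ∧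
    ∀ (H : ℕ) (S A B : Type*) [MeasurableSpace S]
      [Fintype A] [Nonempty A] [MeasurableSpace A] [MeasurableSingletonClass A]
      [Fintype B] [Nonempty B] [MeasurableSpace B] [MeasurableSingletonClass B]
      (M : MarkovGames.Game H S A B)
      (F G : Fin H → Finset (S × A × B → ℝ))
      (_ : MarkovGames.IsValueClass F) (_ : MarkovGames.IsValueClass G)
      (εreal εcomp : ℝ)
      (_ : M.Realizable F εreal) (_ : M.Complete F G εcomp)
      (δ : ℝ) (_ : 0 < δ) (_ : δ ≤ 1) (K : ℕ) (β : ℝ)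
      (_ : β = c * (Real.log (K * H * MarkovGames.classCard F * MarkovGames.classCard G / δ)
        + K * εcomp ^ 2 + K * εreal ^ 2))
      (d : ℕ) (_ : M.dimOBE F (1 / K) = d)
      (Ω : Type*) [mΩ : MeasurableSpace Ω] (P : MeasureTheory.Measure Ω)
      [MeasureTheory.IsProbabilityMeasure P] (𝓖 : MeasureTheory.Filtration ℕ mΩ)
      (f : ℕ → Ω → Fin H → S × A × B → ℝ)
      (μ : ℕ → Ω → MarkovGames.Policy H S A) (ν : ℕ → Ω → MarkovGames.Policy H S B)
      (τ : ℕ → Ω → Fin H → S × A × B)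
      (_ : MarkovGames.IsOnlineRun M P F G β K 𝓖 f μ ν τ),
      ENNReal.ofReal (1 - δ) ≤ P {ω | ∀ k ≤ K,
        ∑ t ∈ Finset.range k, (M.Vstar 0 M.init - M.V (μ t ω) (ν t ω) 0 M.init)
          ≤ C * H * √(max (d : ℝ) 1 * k * β)} := by
  refine ⟨8, by norm_num, 10, by norm_num, ?_⟩
  intro H S A B _ _ _ _ _ _ _ _ _ M F G hF hG εreal εcomp hreal hcomp δ hδ0 hδ1 K β hβ d hd
    Ω _ P _ 𝓖 f μ ν τ hrun
  -- For `H = 0` or `K = 0` the logarithm takes its default value `log 0 = 0`, but all values vanish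
  -- or there is no episode.
  obtain hHK | ⟨hH, hK⟩ : (H = 0 ∨ K = 0) ∨ (0 < H ∧ 0 < K) := by omega
  · refine MarkovGames.ofReal_one_sub_le_measure hδ0.le ?_
    rw [show {ω | ∀ k ≤ K,
        ∑ t ∈ Finset.range k, (M.Vstar 0 M.init - M.V (μ t ω) (ν t ω) 0 M.init)
          ≤ 10 * H * √(max (d : ℝ) 1 * k * β)} = Set.univ from
      Set.eq_univ_of_forall fun ω k hk => ?_]
    · simp
    · obtain rfl | rfl := hHK
      · have hV : ∀ μ ν s, M.V μ ν 0 s = 0 := fun μ ν s =>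
          MarkovGames.Game.valueOf_of_le M μ ν M.reward le_rfl s
        simp [MarkovGames.Game.Vstar, hV]
      · obtain rfl : k = 0 := by omega
        simp
  · exact hrun.regret_le hF hG hreal hcomp hδ0 hδ1 hH hK hβ hd
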